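/- Write $\mathbb T^2=\mathbb R^2/\mathbb Z^2$, and for $f\in\operatorname{Diff}^2(\mathbb T^2)$ let $A_f=\Upsilon(f)\in GL(2,\mathbb Z)$ be the matrix whose induced automorphism of $\mathbb T^2$ is homotopic to $f$. A family $\mathcal S\subseteq\operatorname{Diff}^2(\mathbb T^2)$ is called cone hyperbolic if, for some Riemannian metric on $\mathbb T^2$, there are continuous cone fields $\mathcal C^s,\mathcal C^u$, each consisting of cones $\{a+b: a\in V_x,\ b\perp V_x,\ |b|\le\kappa_x|a|\}$ around lines $V_x$ with $0<\kappa_x<1$, and a number $\gamma>0$ such that, for every $f\in\mathcal S$, $Df$ maps $\mathcal C^u$ into itself and $Df^{-1}$ maps $\mathcal C^s$ into itself, and each stretches the nonzero vectors of the respective cones by a factor greater than $e^{\gamma}$. Let $\mathcal A\subset GL(2,\mathbb Z)$ be a finite cone hyperbolic family of automorphisms, and let $\mathcal K\subseteq\operatorname{Diff}^2(\mathbb T^2)$ be a cone hyperbolic family with $A_f\in\mathcal A$ for every $f\in\mathcal K$; for instance, any subset of a sufficiently small $C^2$-neighbourhood of $\mathcal A$. Let $\Sigma=\mathcal K^{\mathbb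 Z}$ with the product of the $C^2$ topologies, let $\sigma$ be the left shift, and put $$F(\omega,x)=(\sigma\omega,f_{\omega_0}(x)),\qquad \bar A(\omega,x)=(\sigma\omega,A_{f_{\omega_0}}x)\qquad\text{on }\Sigma\times\mathbb T^2 .$$ Let $H(\omega,x)=(\omega,H_\omega(x))$ be a homeomorphism of $\Sigma\times\mathbb T^2$ with $H\circ F=\bar A\circ H$ and every $H_\omega$ homotopic to the identity (for instance, $C^0$-close to it). Let $\mathcal F^u_\omega$ be the fiberwise unstable foliation of $F$ over $\omega$, whose leaf through $x$ is the global unstable manifold $\{y: d(f_\omega^{-n}x,f_\omega^{-n}y)\to0 \text{ as } n\to+\infty\}$, where $f_\omega^{-n}=f_{\omega_{-n}}^{-1}\circ\cdots\circ f_{\omega_{-1}}^{-1}$. Assume that $H$ is $C^{1+}$ along the fiberwise unstable foliations with bounded derivatives: every $H_\omega$ is differentiable along the leaves of $\mathcal F^u_\omega$, and the leafwise derivative is bounded and continuous on $\Sigma\times\mathbb T^2$ and, for some $\theta>0$, $\theta$-Hölder along the leaves with a uniform constant. For $f\in\mathcal K$ let $\mathcal F^s_f$ be the stable foliation of $f$,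 whose leaf through $x$ is the global stable manifold $\{y:d(f^nx,f^ny)\to0 \text{ as } n\to+\infty\}$, and let $\mathcal L^s_f$ be the linear stable foliation of $A_f$, whose leaf through $x$ is $x+\{v\in\mathbb R^2: A_f^nv\to0 \text{ as } n\to+\infty\}$. Then for all $f,g\in\mathcal K$ and all homeomorphisms $H_f,H_g$ of $\mathbb T^2$ that are homotopic to the identity and satisfy $H_f\circ f=A_f\circ H_f$ and $H_g\circ g=A_g\circ H_g$ (such as $H_f=H_\omega$ for the constant word $\omega=(\dots,f,f,f,\dots)$, and likewise for $g$), one has $$H_f(\mathcal F^s_g)=\mathcal L^s_g\qquad\text{and}\qquad H_g(\mathcal F^s_f)=\mathcal L^s_f,$$ that is, $H_f(\mathcal F^s_g(x))=\mathcal L^s_g(H_f(x))$ and $H_g(\mathcal F^s_f(x))=\mathcal L^s_f(H_g(x))$ for every $x\in\mathbb T^2$. -/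

import Mathlib

open Filter Topology

noncomputable section

/-! ### The two-torus and its `C²` diffeomorphisms -/

/-- The Euclidean plane, the universal cover of the torus. The tangent bundle of the torus is
trivialised by translations, so it is also the tangent space at every point of the torus. -/
abbrev Plane : Type := EuclideanSpace ℝ (Fin 2)

/-- The torus `𝕋² = ℝ² / ℤ²`. -/
abbrev Torus : Type := UnitAddTorus (Fin 2)

/-- The covering map `ℝ² → 𝕋²`. -/
def proj (v : Plane) : Torus := fun i => ((v i : ℝ) : UnitAddCircle)

/-- `f : 𝕋² → 𝕋²` is of class `C²`: it lifts to a `C²` map of the plane. -/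
def IsC2 (f : Torus → Torus) : Prop :=
  ∃ φ : Plane → Plane, ContDiff ℝ 2 φ ∧ ∀ v, proj (φ v) = f (proj v)

/-- The set `Diff²(𝕋²)`. -/
structure Diff2 where
  toHomeo : Torus ≃ₜ Torus
  isC2 : IsC2 toHomeo
  isC2_symm : IsC2 toHomeo.symm

namespace Diff2

instance : CoeFun Diff2 (fun _ => Torus → Torus) := ⟨fun f => f.toHomeo⟩

/-- The inverse diffeomorphism. -/
def symm (f : Diff2) : Diff2 := ⟨f.toHomeo.symm, f.isC2_symm, f.isC2⟩

/-- A lift of `f` to the plane. Two lifts differ by a constant vector of `ℤ²`, so the derivatives of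
the lift do not depend on the choice. -/
def lift (f : Diff2) : Plane → Plane := f.isC2.choose

/-- The derivative `Df` at the point `proj v`, in the translation-invariant trivialisation. -/
def D (f : Diff2) (v : Plane) : Plane →L[ℝ] Plane := fderiv ℝ f.lift v

/-- `f` together with its first two derivatives, as maps in the topology of uniform convergence. -/
def jet (f : Diff2) :
    (UniformFun Torus Torus) × (UniformFun Plane (Plane →L[ℝ] Plane)) ×
      (UniformFun Plane (Plane →L[ℝ] Plane →L[ℝ] Plane)) :=
  (UniformFun.ofFun f, UniformFun.ofFun f.D, UniformFun.ofFun (fderiv ℝ f.D))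

/-- The `C²` topology: uniform convergence of `f`, `f⁻¹` and of their derivatives up to order 2. -/
instance : TopologicalSpace Diff2 :=
  TopologicalSpace.induced (fun f => (f.jet, f.symm.jet)) inferInstance

end Diff2

/-! ### Toral automorphisms and the linear part of a diffeomorphism -/

/-- The map of the torus induced by an integer matrix. -/
def toralMap (A : Matrix (Fin 2) (Fin 2) ℤ) : C(Torus, Torus) where
  toFun x := fun i => ∑ j, A i j • x j
  continuous_toFun := by fun_prop

/-- The action on the plane of an integer matrix. -/
def planeMap (A : Matrix (Fin 2) (Fin 2) ℤ) : Plane →L[ℝ] Plane :=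
  Matrix.toEuclideanCLM (𝕜 := ℝ) (n := Fin 2) (A.map (Int.cast : ℤ → ℝ))

theorem proj_planeMap (A : Matrix (Fin 2) (Fin 2) ℤ) (v : Plane) :
    proj (planeMap A v) = toralMap A (proj v) := by
  funext i
  have h : (planeMap A v) i = ∑ j, (A i j : ℝ) * v j := by
    simp [planeMap, Matrix.ofLp_toEuclideanCLM, Matrix.mulVec, dotProduct]
  simp only [proj, toralMap, ContinuousMap.coe_mk, h, Fin.sum_univ_two, AddCircle.coe_add]
  congr 1 <;> rw [← zsmul_eq_mul, AddCircle.coe_zsmul]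

theorem toralMap_mul (A B : Matrix (Fin 2) (Fin 2) ℤ) (x : Torus) :
    toralMap A (toralMap B x) = toralMap (A * B) x := by
  funext i
  simp only [toralMap, ContinuousMap.coe_mk, Matrix.mul_apply, Fin.sum_univ_two, smul_add,
    add_smul, mul_smul]
  abel

theorem toralMap_one (x : Torus) : toralMap 1 x = x := by
  funext i
  fin_cases i <;> simp [toralMap, Fin.sum_univ_two]

/-- The automorphism of the torus induced by `A ∈ GL(2,ℤ)`. -/
def toralAut (A : GL (Fin 2) ℤ) : Diff2 where
  toHomeo :=
    { toFun := toralMap A.val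
      invFun := toralMap (A⁻¹).val
      left_inv := fun x => by
        rw [toralMap_mul, ← Units.val_mul, inv_mul_cancel, Units.val_one, toralMap_one]
      right_inv := fun x => by
        rw [toralMap_mul, ← Units.val_mul, mul_inv_cancel, Units.val_one, toralMap_one]
      continuous_toFun := (toralMap A.val).continuous
      continuous_invFun := (toralMap (A⁻¹).val).continuous }
  isC2 := ⟨planeMap A.val, (planeMap A.val).contDiff, proj_planeMap A.val⟩
  isC2_symm := ⟨planeMap (A⁻¹).val, (planeMap (A⁻¹).val).contDiff, proj_planeMap (A⁻¹).val⟩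

/-- The linear part `Υ(f) ∈ GL(2,ℤ)`: the matrix whose induced map of the torus is homotopic to `f`
(equivalently, the action of `f` on the first homology). It exists and is unique for every
homeomorphism of the torus. -/
def linPart (f : Diff2) : GL (Fin 2) ℤ :=
  Classical.epsilon fun A : GL (Fin 2) ℤ =>
    ContinuousMap.Homotopic (f.toHomeo : C(Torus, Torus)) (toralMap A.val)

/-! ### Cone hyperbolic families -/

/-- A Riemannian metric on the torus. -/
structure TorusMetric where
  inner : Torus → Plane →L[ℝ] Plane →L[ℝ] ℝ
  smooth : ContDiff ℝ ((⊤ : ℕ∞) : WithTop ℕ∞) fun v : Plane => inner (proj v)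
  symm : ∀ x v w, inner x v w = inner x w v
  pos : ∀ x v, v ≠ 0 → 0 < inner x v v

/-- The length of a tangent vector `v` at `x`. -/
def TorusMetric.len (G : TorusMetric) (x : Torus) (v : Plane) : ℝ := √(G.inner x v v)

/-- A continuous 1-cone-field on the torus, given by a continuous field `V` of lines and a continuous
radius `0 < κ < 1`. Continuity of a field of lines is that of the orthogonal projections. -/
structure ConeField where
  V : Torus → Submodule ℝ Plane
  κ : Torus → ℝ
  finrank_V : ∀ x, Module.finrank ℝ (V x) = 1
  continuous_V : Continuous fun x => (V x).starProjection
  continuous_κ : Continuous κ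
  κ_pos : ∀ x, 0 < κ x
  κ_lt_one : ∀ x, κ x < 1

/-- The cone at `x`: the vectors `a + b` with `a ∈ V`, `b ⊥ V` and `|b| ≤ κ |a|`, where
orthogonality and length are those of the metric `G`. -/
def ConeField.cone (C : ConeField) (G : TorusMetric) (x : Torus) : Set Plane :=
  {w | ∃ a ∈ C.V x, ∃ b : Plane, w = a + b ∧ (∀ a' ∈ C.V x, G.inner x a' b = 0) ∧
    G.len x b ≤ C.κ x * G.len x a}

/-- `f` maps the cones of `C` into themselves and stretches their nonzero vectors by a factor more
than `exp γ`. -/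
def ExpandsCones (G : TorusMetric) (C : ConeField) (γ : ℝ) (f : Diff2) : Prop :=
  ∀ v : Plane, ∀ w ∈ C.cone G (proj v),
    f.D v w ∈ C.cone G (f (proj v)) ∧
      (w ≠ 0 → Real.exp γ * G.len (proj v) w < G.len (f (proj v)) (f.D v w))

/-- A family of diffeomorphisms of the torus is cone hyperbolic: it has common stable and unstable
cone fields. -/
def ConeHyperbolic (S : Set Diff2) : Prop :=
  ∃ (G : TorusMetric) (Cs Cu : ConeField) (γ : ℝ), 0 < γ ∧
    ∀ f ∈ S, ExpandsCones G Cs γ f.symm ∧ ExpandsCones G Cu γ f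

/-! ### Skew products over the full shift -/

/-- The space `𝒦^ℤ` of bi-infinite words in `𝒦`, with the product topology. -/
abbrev Words (𝒦 : Set Diff2) : Type := ℤ → 𝒦

/-- The left shift. -/
def shift {𝒦 : Set Diff2} (ω : Words 𝒦) : Words 𝒦 := fun n => ω (n + 1)

/-- The skew product `F (ω, x) = (σ ω, f_{ω₀} x)`. -/
def skew {𝒦 : Set Diff2} (p : Words 𝒦 × Torus) : Words 𝒦 × Torus :=
  (shift p.1, (p.1 0).1 p.2)

/-- The linear skew product `Ā (ω, x) = (σ ω, Υ(f_{ω₀}) x)`. -/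
def linSkew {𝒦 : Set Diff2} (p : Words 𝒦 × Torus) : Words 𝒦 × Torus :=
  (shift p.1, toralMap (linPart (p.1 0).1).val p.2)

/-- The backward fiber iterate `f_ω^{-n} = f_{ω_{-n}}⁻¹ ∘ ⋯ ∘ f_{ω_{-1}}⁻¹`. -/
def backIter {𝒦 : Set Diff2} (ω : Words 𝒦) : ℕ → Torus → Torus
  | 0 => id
  | n + 1 => fun x => (ω (-(n + 1 : ℤ))).1.symm (backIter ω n x)

/-! ### Stable and unstable foliations -/

/-- The leaf through `x` of the fiberwise unstable foliation on the fiber over `ω`: the global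
unstable manifold. -/
def unstableLeaf {𝒦 : Set Diff2} (ω : Words 𝒦) (x : Torus) : Set Torus :=
  {y | Tendsto (fun n : ℕ => dist (backIter ω n x) (backIter ω n y)) atTop (𝓝 0)}

/-- The leaf through `x` of the stable foliation of `f`: the global stable manifold. -/
def stableLeaf (f : Diff2) (x : Torus) : Set Torus :=
  {y | Tendsto (fun n : ℕ => dist (f^[n] x) (f^[n] y)) atTop (𝓝 0)}

/-- The stable subspace of `A`. -/
def stableSpace (A : GL (Fin 2) ℤ) : Submodule ℝ Plane where
  carrier := {v | Tendsto (fun n : ℕ => ((planeMap A.val) ^ n) v) atTop (𝓝 0)}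
  add_mem' := fun {v w} hv hw => by simpa using Tendsto.add hv hw
  zero_mem' := by simp
  smul_mem' := fun c v hv => by simpa only [Set.mem_ofPred_eq, map_smul, smul_zero] using Tendsto.const_smul hv c

/-- The leaf `x + E^s` through `x` of the linear stable foliation of `A`. -/
def linStableLeaf (A : GL (Fin 2) ℤ) (x : Torus) : Set Torus :=
  {y | ∃ v ∈ stableSpace A, y = x + proj v}

/-- The homeomorphism `h` maps the leaves of `F` onto the leaves of `L`. -/
def MapsLeaves (h : Torus ≃ₜ Torus) (F L : Torus → Set Torus) : Prop :=
  ∀ x, h '' F x = L (h x)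

/-! ### Conjugacies -/

/-- `h` is a conjugacy from `f` to its linear part, homotopic to the identity. -/
def IsLinConj (f : Diff2) (h : Torus ≃ₜ Torus) : Prop :=
  (∀ x, h (f x) = toralMap (linPart f).val (h x)) ∧
    ContinuousMap.Homotopic (h : C(Torus, Torus)) (ContinuousMap.id Torus)

/-- `H` is a fiberwise conjugacy from the skew product `F` to the linear skew product `Ā`: a
homeomorphism over the identity of `𝒦^ℤ` with `H ∘ F = Ā ∘ H`, whose fiber maps `H_ω` are homotopic
to the identity. -/
structure IsFiberConj {𝒦 : Set Diff2} (H : (Words 𝒦 × Torus) ≃ₜ (Words 𝒦 × Torus)) : Prop where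
  fst_eq : ∀ p, (H p).1 = p.1
  conj : ∀ p, H (skew p) = linSkew (H p)
  homotopic : ∀ ω : Words 𝒦,
    ContinuousMap.Homotopic (⟨fun x : Torus => (H (ω, x)).2, by fun_prop⟩ : C(Torus, Torus))
      (ContinuousMap.id Torus)

/-- The curve `c` in the plane is an arc-length parametrisation of (a lift of) a leaf of the
fiberwise unstable foliation over `ω`. -/
structure IsUnstableParam {𝒦 : Set Diff2} (ω : Words 𝒦) (c : ℝ → Plane) : Prop where
  contDiff : ContDiff ℝ 1 c
  unit_speed : ∀ t, ‖deriv c t‖ = 1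
  mem_leaf : ∀ t, proj (c t) ∈ unstableLeaf ω (proj (c 0))

/-- `H` is `C^{1+}` along the fiberwise unstable foliation with bounded derivatives. Here `DH (ω, x)`
is a linear map whose restriction to the tangent line of the leaf through `x` is the leafwise
derivative of `H_ω` at `x`; its values off this line play no role. The curve `h` is a lift to the
plane of the image of the leaf. The derivative is bounded and continuous on `𝒦^ℤ × 𝕋²`, and Hölder
continuous along the leaves. Neither differentiability of the inverse nor a lower bound for the
derivative is required. -/
def IsC1PlusAlongUnstable {𝒦 : Set Diff2} (H : (Words 𝒦 × Torus) ≃ₜ (Words 𝒦 × Torus)) : Prop :=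
  ∃ (DH : Words 𝒦 × Torus → (Plane →L[ℝ] Plane)) (M θ : ℝ), 0 < θ ∧ Continuous DH ∧
    (∀ p, ‖DH p‖ ≤ M) ∧
    ∀ (ω : Words 𝒦) (c h : ℝ → Plane), IsUnstableParam ω c → Continuous h →
      (∀ t, proj (h t) = (H (ω, proj (c t))).2) →
      (∀ t, HasDerivAt h (DH (ω, proj (c t)) (deriv c t)) t) ∧
        ∀ s t, ‖deriv h s - deriv h t‖ ≤ M * |s - t| ^ θ

end

/-! Fix `f` and `g` and consider the word with past `f` and future `g`. Its fiber map `h₀` is tied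
to `g` by the future and to `f` by the past, and the two links together give the theorem
(`mapsLeaves_of_fiberConj`).

Future. Shifting this word left gives words converging to the constant word `g`, with fiber maps
`hₙ` satisfying `hₙ ∘ gⁿ = A_gⁿ ∘ h₀` and converging uniformly to a homeomorphism. Hence two orbits
of `g` are asymptotic exactly when the difference of their `h₀`-images is contracted to `0` by
`A_g`, so `h₀` maps stable leaves of `g` onto linear ones (`image_stableLeaf_eq`).

Past. Moving the switch to position `n` gives words converging to the constant word `f`, whose fiber
maps `h'ₙ` satisfy `h₀ ∘ fⁿ = A_fⁿ ∘ h'ₙ`. With their leafwise derivatives they converge uniformly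
to the conjugacy `h` over the constant word. Take a periodic point `y` of `f` where the leafwise
derivative of `h` is nonzero. Transport a point of its unstable leaf backward by `n` periods: its
distance to `y` becomes of order `|μ|⁻ᵏⁿ`, with `k` the period and `μ` the unstable eigenvalue, and
there `h'ₖₙ - h` varies by `o(1)` times that distance. Transporting forward multiplies by at most a
constant times `|μ|ᵏⁿ`, so `h₀ - h` is constant on the leaf. The leaf is dense, so `h₀` is a
translate of `h` (`exists_displacement_eq_add_const`).

Any conjugacy of `f` homotopic to the identity is also a translate of `h`
(`exists_eq_add_const_of_conj`), and translations permute linear leaves. The unstable curves needed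
for the past argument come from the cone condition: a continuous unit field in the unstable
direction (`exists_unit_field`), integrated by Peano's theorem (`exists_integral_curve`). -/

noncomputable section

/-! ### The covering `ℝ² → 𝕋²` -/

/-- The point of the lattice `ℤ²` with the given coordinates. -/
def intVec (k : Fin 2 → ℤ) : Plane := WithLp.toLp 2 fun i => (k i : ℝ)

@[simp] theorem intVec_apply (k : Fin 2 → ℤ) (i : Fin 2) : intVec k i = k i := rfl

theorem proj_apply (v : Plane) (i : Fin 2) : proj v i = ((v i : ℝ) : UnitAddCircle) := rfl

theorem proj_add (v w : Plane) : proj (v + w) = proj v + proj w := by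
  funext i; simp [proj]

theorem proj_sub (v w : Plane) : proj (v - w) = proj v - proj w := by
  funext i; simp [proj]

theorem proj_zero : proj 0 = 0 := by
  funext i; simp [proj]

theorem continuous_proj : Continuous proj := by
  refine continuous_pi fun i => ?_
  exact (AddCircle.continuous_mk' (1 : ℝ)).comp (by fun_prop)

theorem proj_surjective : Function.Surjective proj := by
  intro x
  choose v hv using fun i => QuotientAddGroup.mk_surjective (x i)
  exact ⟨WithLp.toLp 2 v, funext hv⟩

theorem proj_eq_zero_iff {v : Plane} : proj v = 0 ↔ ∃ k, v = intVec k := by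
  constructor
  · intro h
    have : ∀ i, ∃ n : ℤ, n • (1 : ℝ) = v i := fun i =>
      (AddCircle.coe_eq_zero_iff (1 : ℝ)).1 (congrFun h i)
    choose k hk using this
    exact ⟨k, by ext i; simpa using (hk i).symm⟩
  · rintro ⟨k, rfl⟩
    funext i
    exact (AddCircle.coe_eq_zero_iff (1 : ℝ)).2 ⟨k i, by simp⟩

theorem proj_eq_proj_iff {v w : Plane} : proj v = proj w ↔ ∃ k, v = w + intVec k := by
  rw [← sub_eq_zero, ← proj_sub, proj_eq_zero_iff]
  simp only [sub_eq_iff_eq_add']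

theorem proj_intVec (k : Fin 2 → ℤ) : proj (intVec k) = 0 := proj_eq_zero_iff.2 ⟨k, rfl⟩

theorem proj_add_intVec (v : Plane) (k : Fin 2 → ℤ) : proj (v + intVec k) = proj v := by
  rw [proj_add, proj_intVec, add_zero]

theorem isOpenMap_proj : IsOpenMap proj := by
  have h1 : IsOpenMap fun v : Fin 2 → ℝ => fun i => ((v i : ℝ) : UnitAddCircle) :=
    IsOpenMap.piMap (fun i => QuotientAddGroup.isOpenMap_coe) (by simp)
  exact h1.comp (EuclideanSpace.equiv (Fin 2) ℝ).toHomeomorph.isOpenMap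

/-- A continuous map with values in `ℤ²` is constant. -/
theorem eq_of_forall_proj_eq_zero {X : Type*} [TopologicalSpace X] [PreconnectedSpace X]
    {δ : X → Plane} (hδ : Continuous δ) (h : ∀ x, proj (δ x) = 0) (x y : X) : δ x = δ y := by
  ext i
  -- In each coordinate, `δ` and the constant `δ y` are lifts of the same map to the circle and
  -- agree at `y`.
  have key := (AddCircle.isCoveringMap_coe (1 : ℝ)).eq_of_comp_eq (A := X)
    (g₁ := fun z => δ z i) (g₂ := fun _ => δ y i) (by fun_prop) (by fun_prop) ?_ y rfl
  · exact congrFun key x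
  · funext z
    have h1 := congrFun (h z) i
    have h2 := congrFun (h y) i
    exact h1.trans h2.symm

theorem dist_proj_le (v w : Plane) : dist (proj v) (proj w) ≤ ‖v - w‖ := by
  rw [dist_eq_norm, ← proj_sub]
  refine (pi_norm_le_iff_of_nonneg (norm_nonneg _)).2 fun i => ?_
  have h1 : ‖(((v - w) i : ℝ) : UnitAddCircle)‖ ≤ ‖(v - w) i‖ :=
    QuotientAddGroup.norm_mk_le_norm
  exact h1.trans (PiLp.norm_apply_le _ i)

theorem exists_small_lift (p : Torus) : ∃ w : Plane, proj w = p ∧ ‖w‖ ≤ 2 * ‖p‖ := by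
  obtain ⟨v, rfl⟩ := proj_surjective p
  -- Rounding leaves coordinates bounded by the sup norm of the point; the factor 2 absorbs the `√2`
  -- of the Euclidean norm.
  refine ⟨v - intVec fun i => round (v i), by rw [proj_sub, proj_intVec, sub_zero], ?_⟩
  have h : ∀ i, |(v - intVec fun i => round (v i)) i| ≤ ‖proj v‖ := by
    intro i
    have := norm_le_pi_norm (proj v) i
    rw [proj_apply, UnitAddCircle.norm_eq] at this
    simpa using this
  rw [EuclideanSpace.norm_eq, Fin.sum_univ_two]
  refine Real.sqrt_le_iff.2 ⟨by positivity, ?_⟩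
  have h0 := h 0
  have h1 := h 1
  simp only [Real.norm_eq_abs]
  nlinarith [abs_nonneg ((v - intVec fun i => round (v i)) 0),
    abs_nonneg ((v - intVec fun i => round (v i)) 1), norm_nonneg (proj v)]

/-- A map homotopic to the identity is a displacement by a continuous vector field. -/
theorem exists_displacement {h : C(Torus, Torus)}
    (hh : ContinuousMap.Homotopic h (ContinuousMap.id Torus)) :
    ∃ D : C(Torus, Plane), ∀ x, h x = x + proj (D x) := by
  obtain ⟨K⟩ := hh.symm
  have cov := AddCircle.isCoveringMap_coe (1 : ℝ)
  -- `K` starts at the identity, so `K p - p.2` vanishes at time `0` and lifts from the zero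
  -- function; the lift at time `1` is the displacement.
  let Kc : Fin 2 → C(unitInterval × Torus, UnitAddCircle) := fun i =>
    ⟨fun p => K p i - p.2 i, by fun_prop⟩
  have h0 : ∀ i (x : Torus), Kc i (0, x) = (((0 : C(Torus, ℝ)) x : ℝ) : UnitAddCircle) := by
    intro i x; simp [Kc]
  let L : Fin 2 → C(unitInterval × Torus, ℝ) := fun i => cov.liftHomotopy (Kc i) 0 (h0 i)
  have hL : ∀ i p, ((L i p : ℝ) : UnitAddCircle) = Kc i p := fun i p =>
    congrFun (cov.liftHomotopy_lifts (Kc i) 0 (h0 i)) p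
  refine ⟨⟨fun x => WithLp.toLp 2 fun i => L i (1, x), ?_⟩, fun x => ?_⟩
  · refine (PiLp.continuous_toLp 2 _).comp (continuous_pi fun i => ?_)
    fun_prop
  · funext i
    have := hL i (1, x)
    simp only [Kc, ContinuousMap.coe_mk, ContinuousMap.Homotopy.apply_one] at this
    simp [proj, this]

/-- The images of the points of finite order are dense. -/
theorem exists_finite_order_mem {U : Set Torus} (hU : IsOpen U) (hne : U.Nonempty) :
    ∃ q ∈ U, ∃ N : ℕ, 0 < N ∧ N • q = 0 := by
  obtain ⟨x, hx⟩ := hne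
  obtain ⟨v, rfl⟩ := proj_surjective x
  have hd : DenseRange (fun r : Fin 2 → ℚ => fun i => (r i : ℝ)) :=
    DenseRange.piMap fun i => Rat.isDenseEmbedding_coe_real.dense
  have ho : IsOpen ((fun w : Fin 2 → ℝ => proj (WithLp.toLp 2 w)) ⁻¹' U) :=
    hU.preimage (continuous_proj.comp (PiLp.continuous_toLp 2 _))
  obtain ⟨r, hr⟩ := hd.exists_mem_open ho ⟨fun i => v i, hx⟩
  refine ⟨_, hr, (r 0).den * (r 1).den, Nat.mul_pos (r 0).den_pos (r 1).den_pos, ?_⟩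
  funext i
  have key : ∀ j, (r j).den • (((r j : ℝ)) : UnitAddCircle) = 0 := by
    intro j
    rw [← AddCircle.coe_nsmul, AddCircle.coe_eq_zero_iff]
    refine ⟨(r j).num, ?_⟩
    have h3 : ((r j).den : ℝ) * (r j : ℝ) = (r j).num := by
      have := Rat.den_mul_eq_num (r j)
      exact_mod_cast this
    simpa using h3.symm
  fin_cases i
  · change ((r 0).den * (r 1).den) • (((r 0 : ℝ)) : UnitAddCircle) = 0
    rw [mul_comm, mul_smul, key, smul_zero]
  · change ((r 0).den * (r 1).den) • (((r 1 : ℝ)) : UnitAddCircle) = 0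
    rw [mul_smul, key, smul_zero]

/-! ### Integer matrices acting on the plane -/

theorem planeMap_apply (A : Matrix (Fin 2) (Fin 2) ℤ) (v : Plane) (i : Fin 2) :
    planeMap A v i = A i 0 * v 0 + A i 1 * v 1 := by
  simp [planeMap, Matrix.ofLp_toEuclideanCLM, Matrix.mulVec, dotProduct, Fin.sum_univ_two]

theorem planeMap_mul (A B : Matrix (Fin 2) (Fin 2) ℤ) :
    planeMap (A * B) = planeMap A * planeMap B := by
  ext v i
  simp only [planeMap_apply, Matrix.mul_apply, Fin.sum_univ_two, mul_apply_eq_comp]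
  push_cast
  ring

theorem planeMap_one : planeMap 1 = 1 := by
  ext v i
  fin_cases i <;> simp [planeMap_apply]

theorem planeMap_pow (A : Matrix (Fin 2) (Fin 2) ℤ) (n : ℕ) :
    planeMap (A ^ n) = planeMap A ^ n := by
  induction n with
  | zero => simp [planeMap_one]
  | succ n ih => rw [pow_succ, pow_succ, planeMap_mul, ih]

theorem planeMap_inv_apply (A : GL (Fin 2) ℤ) (v : Plane) :
    planeMap (A⁻¹).val (planeMap A.val v) = v := by
  rw [← mul_apply_eq_comp, ← planeMap_mul, ← Units.val_mul, inv_mul_cancel,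
    Units.val_one, planeMap_one, one_apply_eq_self]

theorem planeMap_apply_inv (A : GL (Fin 2) ℤ) (v : Plane) :
    planeMap A.val (planeMap (A⁻¹).val v) = v := by
  simpa using planeMap_inv_apply A⁻¹ v

theorem exists_planeMap_intVec (A : Matrix (Fin 2) (Fin 2) ℤ) (k : Fin 2 → ℤ) :
    ∃ l, planeMap A (intVec k) = intVec l :=
  ⟨fun i => A i 0 * k 0 + A i 1 * k 1, by ext i; simp [planeMap_apply]⟩

/-- A splitting of the plane into an unstable and a stable eigenline of `T`, with its coordinate
functionals. -/
structure HyperbolicSplitting (T : Plane →L[ℝ] Plane) where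
  μ : ℝ
  ν : ℝ
  vu : Plane
  vs : Plane
  ℓu : Plane →L[ℝ] ℝ
  ℓs : Plane →L[ℝ] ℝ
  one_lt_μ : 1 < |μ|
  ν_lt_one : |ν| < 1
  vu_ne : vu ≠ 0
  map_vu : T vu = μ • vu
  map_vs : T vs = ν • vs
  decomp : ∀ x, x = ℓu x • vu + ℓs x • vs
  ℓu_map : ∀ x, ℓu (T x) = μ * ℓu x
  ℓs_map : ∀ x, ℓs (T x) = ν * ℓs x

namespace HyperbolicSplitting

variable {T : Plane →L[ℝ] Plane} (S : HyperbolicSplitting T)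
include S

theorem μ_ne : S.μ ≠ 0 := abs_pos.1 (one_pos.trans S.one_lt_μ)

theorem pow_vu (n : ℕ) : (T ^ n) S.vu = S.μ ^ n • S.vu := by
  induction n with
  | zero => simp
  | succ n ih => rw [pow_succ', mul_apply_eq_comp, ih, map_smul, S.map_vu, smul_smul,
      pow_succ]

theorem pow_vs (n : ℕ) : (T ^ n) S.vs = S.ν ^ n • S.vs := by
  induction n with
  | zero => simp
  | succ n ih => rw [pow_succ', mul_apply_eq_comp, ih, map_smul, S.map_vs, smul_smul,
      pow_succ]

theorem ℓu_pow (n : ℕ) (x : Plane) : S.ℓu ((T ^ n) x) = S.μ ^ n * S.ℓu x := by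
  induction n with
  | zero => simp
  | succ n ih => rw [pow_succ', mul_apply_eq_comp, S.ℓu_map, ih]; ring

theorem ℓs_pow (n : ℕ) (x : Plane) : S.ℓs ((T ^ n) x) = S.ν ^ n * S.ℓs x := by
  induction n with
  | zero => simp
  | succ n ih => rw [pow_succ', mul_apply_eq_comp, S.ℓs_map, ih]; ring

/-- Both eigencomponents grow at most like `|μ| ^ n`. The rate is needed without loss: it has to
cancel the backward contraction along unstable lines exactly. -/
theorem exists_norm_pow_le : ∃ C, 0 < C ∧ ∀ (n : ℕ) x, ‖(T ^ n) x‖ ≤ C * |S.μ| ^ n * ‖x‖ := by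
  refine ⟨‖S.ℓu‖ * ‖S.vu‖ + ‖S.ℓs‖ * ‖S.vs‖ + 1, by positivity, fun n x => ?_⟩
  have h1 : (T ^ n) x = (S.ℓu x * S.μ ^ n) • S.vu + (S.ℓs x * S.ν ^ n) • S.vs := by
    conv_lhs => rw [S.decomp x]
    rw [map_add, map_smul, map_smul, S.pow_vu, S.pow_vs, smul_smul, smul_smul]
  have hν : |S.ν| ^ n ≤ |S.μ| ^ n :=
    pow_le_pow_left₀ (abs_nonneg _) (S.ν_lt_one.le.trans S.one_lt_μ.le) n
  have hu := S.ℓu.le_opNorm x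
  have hs := S.ℓs.le_opNorm x
  have hμ : 0 ≤ |S.μ| ^ n := by positivity
  calc ‖(T ^ n) x‖ ≤ ‖S.ℓu x‖ * |S.μ| ^ n * ‖S.vu‖ + ‖S.ℓs x‖ * |S.ν| ^ n * ‖S.vs‖ := by
        rw [h1]
        refine (norm_add_le _ _).trans_eq ?_
        simp [norm_smul]
    _ ≤ (‖S.ℓu‖ * ‖x‖) * |S.μ| ^ n * ‖S.vu‖ + (‖S.ℓs‖ * ‖x‖) * |S.μ| ^ n * ‖S.vs‖ := by
        gcongr
    _ ≤ _ := by nlinarith [mul_nonneg hμ (norm_nonneg x)]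

/-- Vectors with a sequence of bounded preimages lie on the unstable line. -/
theorem ℓs_eq_zero_of_bounded {x : Plane} {B : ℝ}
    (h : ∀ n : ℕ, ∃ y, (T ^ n) y = x ∧ ‖y‖ ≤ B) : S.ℓs x = 0 := by
  have hlim : Tendsto (fun n : ℕ => |S.ν| ^ n * (‖S.ℓs‖ * B)) atTop (𝓝 (0 * (‖S.ℓs‖ * B))) :=
    (tendsto_pow_atTop_nhds_zero_of_lt_one (abs_nonneg _) S.ν_lt_one).mul_const _
  rw [zero_mul] at hlim
  refine abs_nonpos_iff.1 (ge_of_tendsto' hlim fun n => ?_)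
  obtain ⟨y, rfl, hy⟩ := h n
  rw [S.ℓs_pow, abs_mul, abs_pow]
  gcongr
  exact (S.ℓs.le_opNorm y).trans (by gcongr)

/-- Vectors with bounded forward orbit lie on the stable line. -/
theorem ℓu_eq_zero_of_bounded {x : Plane} {B : ℝ} (h : ∀ n : ℕ, ‖(T ^ n) x‖ ≤ B) :
    S.ℓu x = 0 := by
  by_contra hne
  obtain ⟨n, hn⟩ := pow_unbounded_of_one_lt (‖S.ℓu‖ * B / |S.ℓu x|) S.one_lt_μ
  rw [div_lt_iff₀ (abs_pos.2 hne)] at hn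
  have h1 := S.ℓu_pow n x
  have h2 : |S.ℓu ((T ^ n) x)| ≤ ‖S.ℓu‖ * B := (S.ℓu.le_opNorm _).trans (by gcongr; exact h n)
  rw [h1, abs_mul, abs_pow] at h2
  linarith

end HyperbolicSplitting

/-- The unstable line contains no lattice vector. -/
theorem HyperbolicSplitting.ℓs_intVec_ne {A : GL (Fin 2) ℤ}
    (S : HyperbolicSplitting (planeMap A.val)) {k : Fin 2 → ℤ} (hk : S.ℓs (intVec k) = 0) :
    k = 0 := by
  have hx : planeMap A.val (intVec k) = S.μ • intVec k := by
    have h := S.decomp (intVec k)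
    rw [hk, zero_smul, add_zero] at h
    rw [h, map_smul, S.map_vu, smul_comm]
  have hinv : planeMap (A⁻¹).val (intVec k) = S.μ⁻¹ • intVec k := by
    have h := planeMap_inv_apply A (intVec k)
    rw [hx, map_smul] at h
    rw [← h, smul_smul, inv_mul_cancel₀ S.μ_ne, one_smul, h]
  -- Backward images of a lattice vector stay in the lattice while shrinking to `0`, so they
  -- eventually vanish.
  have hn : ∀ n : ℕ, ∃ l, intVec l = (S.μ⁻¹) ^ n • intVec k := by
    intro n
    induction n with
    | zero => exact ⟨k, by simp⟩
    | succ n ih =>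
      obtain ⟨l, hl⟩ := ih
      obtain ⟨l', hl'⟩ := exists_planeMap_intVec (A⁻¹).val l
      refine ⟨l', ?_⟩
      rw [← hl', hl, map_smul, hinv, smul_smul, pow_succ]
  funext i
  by_contra hi
  have h1 : Tendsto (fun n : ℕ => |S.μ⁻¹| ^ n * |(k i : ℝ)|) atTop (𝓝 (0 * |(k i : ℝ)|)) := by
    refine (tendsto_pow_atTop_nhds_zero_of_lt_one (abs_nonneg _) ?_).mul_const _
    rw [abs_inv]
    exact inv_lt_one_of_one_lt₀ S.one_lt_μ
  rw [zero_mul] at h1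
  obtain ⟨n, hn1⟩ := (h1.eventually (gt_mem_nhds one_pos)).exists
  obtain ⟨l, hl⟩ := hn n
  have h2 : (l i : ℝ) = (S.μ⁻¹) ^ n * k i := by
    have := congrArg (fun v : Plane => v i) hl
    simpa using this
  have h3 : |(l i : ℝ)| < 1 := by rwa [h2, abs_mul, abs_pow]
  have h4 : l i = 0 := by
    have : |l i| < 1 := by exact_mod_cast h3
    exact Int.abs_lt_one_iff.1 this
  rw [h4, Int.cast_zero] at h2
  have h5 := mul_eq_zero.1 h2.symm
  rcases h5 with h5 | h5
  · exact pow_ne_zero n (inv_ne_zero S.μ_ne) h5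
  · exact hi (by exact_mod_cast h5)

/-- For each root `x` of the characteristic polynomial, `(b, x - a)` is an eigenvector once `b ≠ 0`.
If `b = 0`, the roots are the diagonal entries, integers with product `±1`, contradicting `1 < |μ|`.
-/
theorem HyperbolicSplitting.nonempty_of_roots {A : Matrix (Fin 2) (Fin 2) ℤ}
    (hdet : |A.det| = 1) {μ ν : ℝ} (hsum : μ + ν = A.trace) (hprod : μ * ν = A.det)
    (hμ : 1 < |μ|) (hν : |ν| < 1) : Nonempty (HyperbolicSplitting (planeMap A)) := by
  obtain ⟨a, ha⟩ : ∃ a : ℝ, a = A 0 0 := ⟨_, rfl⟩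
  obtain ⟨b, hb⟩ : ∃ a : ℝ, a = A 0 1 := ⟨_, rfl⟩
  obtain ⟨c, hc⟩ : ∃ a : ℝ, a = A 1 0 := ⟨_, rfl⟩
  obtain ⟨d, hd⟩ : ∃ a : ℝ, a = A 1 1 := ⟨_, rfl⟩
  have hT : ∀ v, planeMap A v = WithLp.toLp 2 ![a * v 0 + b * v 1, c * v 0 + d * v 1] := by
    intro v
    ext i
    fin_cases i <;> simp [planeMap_apply, ha, hb, hc, hd]
  rw [Matrix.trace_fin_two] at hsum
  have hdet' := hdet
  rw [Matrix.det_fin_two] at hprod hdet'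
  push_cast at hsum hprod
  rw [← ha, ← hd] at hsum
  rw [← ha, ← hb, ← hc, ← hd] at hprod
  have hne : μ - ν ≠ 0 := by
    intro h
    rw [sub_eq_zero.1 h] at hμ
    exact absurd hμ (not_lt.2 hν.le)
  have hb0 : b ≠ 0 := by
    intro h
    have hA : A 0 1 = 0 := by
      rw [h] at hb
      exact_mod_cast hb.symm
    rw [hA, zero_mul, sub_zero, abs_mul] at hdet'
    have h1 : |A 0 0| = 1 := Int.eq_one_of_mul_eq_one_right (abs_nonneg _) hdet'
    have h2 : |A 1 1| = 1 := Int.eq_one_of_mul_eq_one_left (abs_nonneg _) hdet'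
    have h1' : |a| = 1 := by rw [ha]; exact_mod_cast h1
    have h2' : |d| = 1 := by rw [hd]; exact_mod_cast h2
    have h3 : (μ - a) * (μ - d) = 0 := by
      rw [h] at hprod
      linear_combination μ * hsum - hprod
    rcases mul_eq_zero.1 h3 with h4 | h4
    · rw [sub_eq_zero.1 h4, h1'] at hμ; exact lt_irrefl _ hμ
    · rw [sub_eq_zero.1 h4, h2'] at hμ; exact lt_irrefl _ hμ
  let p0 : Plane →L[ℝ] ℝ := EuclideanSpace.proj 0
  let p1 : Plane →L[ℝ] ℝ := EuclideanSpace.proj 1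
  refine ⟨⟨μ, ν, WithLp.toLp 2 ![b, μ - a], WithLp.toLp 2 ![b, ν - a],
    (μ - ν)⁻¹ • (p1 - ((ν - a) / b) • p0), (μ - ν)⁻¹ • (((μ - a) / b) • p0 - p1),
    hμ, hν, ?_, ?_, ?_, ?_, ?_, ?_⟩⟩
  · intro h
    exact hb0 (by simpa using congrArg (fun v : Plane => v 0) h)
  · rw [hT]
    ext i
    fin_cases i
    · simp; ring
    · simp; linear_combination hprod - μ * hsum
  · rw [hT]
    ext i
    fin_cases i
    · simp; ring
    · simp; linear_combination hprod - ν * hsum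
  · intro x
    ext i
    fin_cases i
    · simp [p0, p1]; field_simp; ring
    · simp [p0, p1]; field_simp; ring
  · intro x
    rw [hT]
    simp [p0, p1]
    field_simp
    linear_combination x 0 * hprod - (a * x 0 + b * x 1) * hsum
  · intro x
    rw [hT]
    simp [p0, p1]
    field_simp
    linear_combination (-x 0) * hprod + (a * x 0 + b * x 1) * hsum

/-- An integer matrix of determinant `±1` some orbit of which grows exponentially is hyperbolic. -/
theorem HyperbolicSplitting.nonempty_of_growth {A : Matrix (Fin 2) (Fin 2) ℤ}
    (hdet : |A.det| = 1) {K r : ℝ} (hr0 : 0 ≤ r) (hr : r < 1) {w : Plane} (hw : w ≠ 0)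
    (h : ∀ n : ℕ, ‖w‖ ≤ K * r ^ n * ‖(planeMap A ^ n) w‖) :
    Nonempty (HyperbolicSplitting (planeMap A)) := by
  -- Exponential growth excludes linear growth along multiples of 12, a common multiple of the
  -- periods 2, 3, 4, 6 met in the finite-order cases below.
  have hlin : ∀ C : ℝ, 0 ≤ C → ¬ ∀ m : ℕ, ‖(planeMap A ^ (12 * m)) w‖ ≤ C * (1 + m) := by
    intro C hC hm
    have h12 : r ^ 12 < 1 := pow_lt_one₀ hr0 hr (by norm_num)
    have l1 := tendsto_pow_atTop_nhds_zero_of_lt_one (pow_nonneg hr0 12) h12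
    have l2 := tendsto_self_mul_const_pow_of_lt_one (pow_nonneg hr0 12) h12
    have l3 := ((l1.add l2).const_mul (|K| * C))
    rw [add_zero, mul_zero] at l3
    have hle : ∀ m : ℕ, ‖w‖ ≤ |K| * C * ((r ^ 12) ^ m + m * (r ^ 12) ^ m) := by
      intro m
      calc ‖w‖ ≤ K * r ^ (12 * m) * ‖(planeMap A ^ (12 * m)) w‖ := h _
        _ ≤ |K| * r ^ (12 * m) * (C * (1 + m)) := by
          gcongr
          · exact le_abs_self K
          · exact hm m
        _ = _ := by rw [pow_mul]; ring
    exact hw (norm_le_zero_iff.1 (ge_of_tendsto' l3 hle))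
  obtain ⟨t, ht⟩ : ∃ t, t = A.trace := ⟨_, rfl⟩
  obtain ⟨D, hD⟩ : ∃ D, D = A.det := ⟨_, rfl⟩
  have hCH : A ^ 2 = t • A - D • 1 := by
    rw [ht, hD, Matrix.trace_fin_two, Matrix.det_fin_two, pow_two]
    ext i j
    simp only [Matrix.mul_apply, Fin.sum_univ_two, Matrix.sub_apply, Matrix.smul_apply,
      Matrix.one_apply, smul_eq_mul]
    fin_cases i <;> fin_cases j <;> simp <;> ring
  have hper : A ^ 12 ≠ 1 := by
    intro h1
    refine hlin ‖w‖ (norm_nonneg _) fun m => ?_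
    rw [pow_mul, ← planeMap_pow A 12, h1, planeMap_one, one_pow, one_apply_eq_self]
    nlinarith [norm_nonneg w, mul_nonneg (norm_nonneg w) (Nat.cast_nonneg (α := ℝ) m)]
  -- A double eigenvalue `s = ±1` means `(A - s)² = 0`, which makes every orbit grow at most
  -- linearly.
  have hpar : ∀ s : ℤ, s * s = 1 → A ^ 2 ≠ (2 * s) • A - 1 := by
    intro s hs h2
    have hs' : (s : ℝ) * s = 1 := by exact_mod_cast hs
    have hT : ∀ v, planeMap A (planeMap A v) = (2 * s : ℝ) • planeMap A v - v := by
      intro v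
      rw [← mul_apply_eq_comp, ← planeMap_mul, ← pow_two, h2]
      ext i
      fin_cases i <;> simp [-zsmul_eq_mul, planeMap_apply] <;> ring
    have hform : ∀ n : ℕ, (planeMap A ^ n) w
        = (s : ℝ) ^ n • (w + (n : ℝ) • ((s : ℝ) • planeMap A w - w)) := by
      intro n
      induction n with
      | zero => simp
      | succ n ih =>
        rw [pow_succ', mul_apply_eq_comp, ih]
        simp only [map_smul, map_add, map_sub, hT]
        push_cast
        generalize planeMap A w = u at *
        ext i
        simp only [PiLp.add_apply, PiLp.smul_apply, PiLp.sub_apply, smul_eq_mul]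
        linear_combination ((s : ℝ) ^ n * (n - 1) * u i) * hs'
    refine hlin (‖w‖ + 12 * ‖(s : ℝ) • planeMap A w - w‖) (by positivity) fun m => ?_
    rw [hform, norm_smul]
    have hs1 : ‖(s : ℝ) ^ (12 * m)‖ = 1 := by
      have : |(s : ℝ)| = 1 := by
        have := abs_mul_abs_self (s : ℝ)
        rw [hs'] at this
        nlinarith [abs_nonneg (s : ℝ)]
      rw [Real.norm_eq_abs, abs_pow, this, one_pow]
    rw [hs1, one_mul]
    refine (norm_add_le _ _).trans ?_
    rw [norm_smul]
    simp only [Real.norm_natCast]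
    push_cast
    nlinarith [norm_nonneg w, norm_nonneg ((s : ℝ) • planeMap A w - w),
      mul_nonneg (norm_nonneg w) (Nat.cast_nonneg (α := ℝ) m)]
  have hDcase : D = 1 ∨ D = -1 := by
    rw [← hD] at hdet
    exact (abs_eq one_pos.le).1 hdet
  -- A nonpositive discriminant forces `D = 1` and `|t| ≤ 2`: traces `±2` are parabolic, the others
  -- have finite order. The case `t = 0`, `D = -1` has eigenvalues `±1` and `A ^ 2 = 1`.
  have hΔ : 0 < t ^ 2 - 4 * D ∧ ¬(t = 0 ∧ D = -1) := by
    constructor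
    · by_contra hneg
      push Not at hneg
      rcases hDcase with rfl | rfl
      · have h1 : t ≤ 2 := by nlinarith
        have h2 : -2 ≤ t := by nlinarith
        interval_cases t
        · exact hpar (-1) (by norm_num) (by rw [hCH]; simp)
        · refine hper ?_
          have h3 : A ^ 3 = 1 := by
            rw [pow_succ, hCH, sub_mul, smul_mul_assoc, ← pow_two, hCH]
            simp
          rw [show 12 = 3 * 4 from rfl, pow_mul, h3, one_pow]
        · refine hper ?_
          rw [show 12 = 2 * 6 from rfl, pow_mul, hCH]
          simp [Even.neg_one_pow (show Even 6 by decide)]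
        · refine hper ?_
          have h3 : A ^ 3 = -1 := by
            rw [pow_succ, hCH, sub_mul, smul_mul_assoc, ← pow_two, hCH]
            simp
          rw [show 12 = 3 * 4 from rfl, pow_mul, h3]
          simp [Even.neg_one_pow (show Even 4 by decide)]
        · exact hpar 1 (by norm_num) (by rw [hCH]; simp)
      · nlinarith [sq_nonneg t]
    · rintro ⟨rfl, rfl⟩
      refine hper ?_
      rw [show 12 = 2 * 6 from rfl, pow_mul, hCH]
      simp
  obtain ⟨hΔ, hexc⟩ := hΔ
  have hΔ' : (0 : ℝ) < (t : ℝ) ^ 2 - 4 * D := by exact_mod_cast hΔ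
  obtain ⟨q, hq, hq2⟩ : ∃ q : ℝ, 0 < q ∧ q ^ 2 = (t : ℝ) ^ 2 - 4 * D :=
    ⟨_, Real.sqrt_pos.2 hΔ', Real.sq_sqrt hΔ'.le⟩
  have hs1 : (t + q) / 2 + (t - q) / 2 = (A.trace : ℝ) := by rw [← ht]; ring
  have hp1 : (t + q) / 2 * ((t - q) / 2) = (A.det : ℝ) := by
    rw [← hD]; linear_combination (-1 / 4) * hq2
  have habs : |(t + q) / 2| * |(t - q) / 2| = 1 := by
    rw [← abs_mul, hp1, ← Int.cast_abs, hdet, Int.cast_one]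
  have hne1 : |(t + q) / 2| ≠ 1 := by
    intro h1
    have h2 : |(t - q) / 2| = 1 := by rwa [h1, one_mul] at habs
    have h3 : (t : ℝ) = 0 ∧ q = 2 := by
      rcases (abs_eq one_pos.le).1 h1 with h1 | h1 <;>
        rcases (abs_eq one_pos.le).1 h2 with h2 | h2 <;> constructor <;> linarith
    refine hexc ⟨by exact_mod_cast h3.1, ?_⟩
    rw [h3.1, h3.2] at hq2
    have : (D : ℝ) = -1 := by linarith
    exact_mod_cast this
  rcases lt_or_gt_of_ne hne1 with hlt | hgt
  · refine nonempty_of_roots hdet (μ := (t - q) / 2) (ν := (t + q) / 2) (by rw [add_comm, hs1])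
      (by rw [mul_comm, hp1]) ?_ hlt
    by_contra hcon
    push Not at hcon
    nlinarith [abs_nonneg (((t : ℝ) + q) / 2), abs_nonneg (((t : ℝ) - q) / 2)]
  · refine nonempty_of_roots hdet hs1 hp1 hgt ?_
    by_contra hcon
    push Not at hcon
    nlinarith [abs_nonneg (((t : ℝ) + q) / 2), abs_nonneg (((t : ℝ) - q) / 2)]

/-! ### Lifts of diffeomorphisms and growth of tangent vectors in cones -/

theorem Diff2.contDiff_lift (f : Diff2) : ContDiff ℝ 2 f.lift := f.isC2.choose_spec.1

theorem Diff2.proj_lift (f : Diff2) (v : Plane) : proj (f.lift v) = f (proj v) :=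
  f.isC2.choose_spec.2 v

/-- Two continuous lifts differ by a constant. This frees `D` from its chosen lift, so that linear
lifts and mutually inverse lifts can be used. -/
theorem Diff2.D_eq_fderiv (f : Diff2) {φ : Plane → Plane} (hφ : Continuous φ)
    (hl : ∀ v, proj (φ v) = f (proj v)) (v : Plane) : f.D v = fderiv ℝ φ v := by
  have h : ∀ w, f.lift w - φ w = f.lift 0 - φ 0 := fun w =>
    eq_of_forall_proj_eq_zero (f.contDiff_lift.continuous.sub hφ)
      (fun x => by
        rw [Pi.sub_apply, proj_sub, f.proj_lift, hl, sub_self]) w 0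
  have h2 : φ = fun w => f.lift w - (f.lift 0 - φ 0) := by
    funext w
    rw [← h w, sub_sub_cancel]
  rw [Diff2.D, h2, fderiv_sub_const]

theorem TorusMetric.continuous_inner (G : TorusMetric) : Continuous G.inner := by
  have hq : IsQuotientMap proj :=
    isOpenMap_proj.isQuotientMap continuous_proj proj_surjective
  exact hq.continuous_iff.2 G.smooth.continuous

theorem TorusMetric.len_smul (G : TorusMetric) (x : Torus) (c : ℝ) (v : Plane) :
    G.len x (c • v) = |c| * G.len x v := by
  rw [TorusMetric.len, TorusMetric.len, ← Real.sqrt_sq_eq_abs, ← Real.sqrt_mul (sq_nonneg c)]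
  congr 1
  simp
  ring

/-- Compactness of the torus makes the lengths of a Riemannian metric comparable to the norm. -/
theorem TorusMetric.exists_bounds (G : TorusMetric) : ∃ a b : ℝ, 0 < a ∧ 0 < b ∧
    ∀ x v, a * ‖v‖ ≤ G.len x v ∧ G.len x v ≤ b * ‖v‖ := by
  let F : Torus × Metric.sphere (0 : Plane) 1 → ℝ := fun p => G.len p.1 p.2
  have hF : Continuous F := by
    have := G.continuous_inner
    have h2 : Continuous fun p : Torus × Metric.sphere (0 : Plane) 1 => (p.2 : Plane) := by
      fun_prop
    exact Real.continuous_sqrt.comp (((this.comp continuous_fst).clm_apply h2).clm_apply h2)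
  obtain ⟨e, he⟩ : ∃ e : Plane, ‖e‖ = 1 := exists_norm_eq Plane one_pos.le
  have hne : (Set.univ : Set (Torus × Metric.sphere (0 : Plane) 1)).Nonempty :=
    ⟨(0, ⟨e, by simp [he]⟩), trivial⟩
  obtain ⟨p, -, hp⟩ := isCompact_univ.exists_isMinOn hne hF.continuousOn
  obtain ⟨q, -, hq⟩ := isCompact_univ.exists_isMaxOn hne hF.continuousOn
  have hpos : ∀ r, 0 < F r := by
    intro r
    refine Real.sqrt_pos.2 (G.pos _ _ fun h => ?_)
    have h1 : ‖(r.2 : Plane)‖ = 1 := by simp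
    rw [h, norm_zero] at h1
    exact zero_ne_one h1
  refine ⟨F p, F q, hpos p, hpos q, fun x v => ?_⟩
  rcases eq_or_ne v 0 with rfl | hv
  · simp [TorusMetric.len]
  have hv' : 0 < ‖v‖ := norm_pos_iff.2 hv
  have hu : ‖‖v‖⁻¹ • v‖ = 1 := by
    rw [norm_smul, norm_inv, norm_norm, inv_mul_cancel₀ hv'.ne']
  let r : Torus × Metric.sphere (0 : Plane) 1 := (x, ⟨‖v‖⁻¹ • v, by simp [hu]⟩)
  have h1 : G.len x v = ‖v‖ * F r := by
    change _ = ‖v‖ * G.len x (‖v‖⁻¹ • v)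
    rw [G.len_smul, abs_of_pos (inv_pos.2 hv'), mul_inv_cancel_left₀ hv'.ne']
  have h2 : F p ≤ F r := hp (Set.mem_univ r)
  have h3 : F r ≤ F q := hq (Set.mem_univ r)
  rw [h1, mul_comm (F p), mul_comm (F q)]
  exact ⟨by gcongr, by gcongr⟩

theorem ConeField.exists_mem_cone (C : ConeField) (G : TorusMetric) (x : Torus) :
    ∃ w ∈ C.cone G x, w ≠ 0 := by
  have hpos : 0 < Module.finrank ℝ (C.V x) := by rw [C.finrank_V x]; exact one_pos
  have := Module.nontrivial_of_finrank_pos hpos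
  obtain ⟨w, hw⟩ := exists_ne (0 : C.V x)
  refine ⟨w, ⟨w, w.2, 0, (add_zero _).symm, fun _ _ => map_zero _, ?_⟩, by simpa using hw⟩
  have : G.len x 0 = 0 := by simp [TorusMetric.len]
  rw [this]
  exact mul_nonneg (C.κ_pos x).le (Real.sqrt_nonneg _)

theorem fderiv_iterate_succ {φ : Plane → Plane} (hφ : ContDiff ℝ 1 φ) (n : ℕ) (v w : Plane) :
    fderiv ℝ φ^[n + 1] v w = fderiv ℝ φ (φ^[n] v) (fderiv ℝ φ^[n] v w) := by
  have hd : Differentiable ℝ φ := hφ.differentiable one_ne_zero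
  rw [Function.iterate_succ', fderiv_comp _ (hd _) (hd.iterate n _)]
  rfl

/-- Uniform exponential growth, along the orbits of `φ`, of some vector at every point. -/
def HasGrowth (K r : ℝ) (φ : Plane → Plane) : Prop :=
  ∀ v, ∃ w : Plane, w ≠ 0 ∧ ∀ i j : ℕ,
    ‖fderiv ℝ φ^[i] v w‖ ≤ K * r ^ j * ‖fderiv ℝ φ^[j + i] v w‖

/-- A cone vector stays in the cones along its orbit and gains `exp γ` at each step in the metric
`G`. Comparing `G` with the Euclidean norm costs `b / a` once, independently of the number of steps.
-/
theorem ExpandsCones.exists_hasGrowth {G : TorusMetric} {C : ConeField} {γ : ℝ} {f : Diff2}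
    (h : ExpandsCones G C γ f) {φ : Plane → Plane} (hφ : ContDiff ℝ 1 φ)
    (hl : ∀ v, proj (φ v) = f (proj v)) : ∃ K, 0 < K ∧ HasGrowth K (Real.exp (-γ)) φ := by
  obtain ⟨a, b, ha, hb, hab⟩ := G.exists_bounds
  refine ⟨b / a, by positivity, fun v => ?_⟩
  obtain ⟨w, hw, hw0⟩ := C.exists_mem_cone G (proj v)
  refine ⟨w, hw0, ?_⟩
  have hmem : ∀ n, fderiv ℝ φ^[n] v w ∈ C.cone G (proj (φ^[n] v)) := by
    intro n
    induction n with
    | zero => simpa using hw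
    | succ n ih =>
      have := (h _ _ ih).1
      rw [f.D_eq_fderiv hφ.continuous hl, ← fderiv_iterate_succ hφ, ← hl] at this
      rwa [Function.iterate_succ_apply']
  have hlen : ∀ i j, G.len (proj (φ^[i] v)) (fderiv ℝ φ^[i] v w)
      ≤ Real.exp (-γ) ^ j * G.len (proj (φ^[j + i] v)) (fderiv ℝ φ^[j + i] v w) := by
    intro i j
    induction j with
    | zero => simp
    | succ j ih =>
      refine ih.trans ?_
      rw [pow_succ, mul_assoc]
      gcongr
      have hstep : Real.exp γ * G.len (proj (φ^[j + i] v)) (fderiv ℝ φ^[j + i] v w)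
          ≤ G.len (proj (φ^[j + i + 1] v)) (fderiv ℝ φ^[j + i + 1] v w) := by
        rcases eq_or_ne (fderiv ℝ φ^[j + i] v w) 0 with h0 | h0
        · rw [h0]
          simp only [TorusMetric.len, map_zero, Real.sqrt_zero, mul_zero]
          exact Real.sqrt_nonneg _
        · have := (h _ _ (hmem (j + i))).2 h0
          rw [f.D_eq_fderiv hφ.continuous hl, ← fderiv_iterate_succ hφ, ← hl] at this
          rw [Function.iterate_succ_apply']
          exact this.le
      rw [show j + 1 + i = j + i + 1 by ring, Real.exp_neg, inv_mul_eq_div,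
        le_div_iff₀ (Real.exp_pos _), mul_comm]
      exact hstep
  intro i j
  have h1 := (hab (proj (φ^[i] v)) (fderiv ℝ φ^[i] v w)).1
  have h2 := (hab (proj (φ^[j + i] v)) (fderiv ℝ φ^[j + i] v w)).2
  have h3 := hlen i j
  rw [div_mul_eq_mul_div, div_mul_eq_mul_div, le_div_iff₀ ha, mul_comm]
  calc _ ≤ _ := h1
    _ ≤ _ := h3
    _ ≤ Real.exp (-γ) ^ j * (b * ‖fderiv ℝ φ^[j + i] v w‖) := by gcongr
    _ = _ := by ring

/-- The elements of a cone hyperbolic family of automorphisms are hyperbolic matrices. -/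
theorem nonempty_hyperbolicSplitting {𝒜 : Set (GL (Fin 2) ℤ)}
    (h : ConeHyperbolic (toralAut '' 𝒜)) {A : GL (Fin 2) ℤ} (hA : A ∈ 𝒜) :
    Nonempty (HyperbolicSplitting (planeMap A.val)) := by
  obtain ⟨G, Cs, Cu, γ, hγ, hS⟩ := h
  obtain ⟨K, -, hK⟩ := (hS _ ⟨A, hA, rfl⟩).2.exists_hasGrowth
    (planeMap A.val).contDiff (proj_planeMap A.val)
  obtain ⟨w, hw, hgrow⟩ := hK 0
  have hdet : |A.val.det| = 1 := by
    have : IsUnit A.val.det := Matrix.isUnits_det_units A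
    exact Int.isUnit_iff_abs_eq.1 this
  refine HyperbolicSplitting.nonempty_of_growth hdet (Real.exp_pos (-γ)).le
    (by simpa using hγ) hw (K := K) fun n => ?_
  have h1 := hgrow 0 n
  have h2 : ∀ n : ℕ, (planeMap A.val)^[n] = ⇑(planeMap A.val ^ n) := fun n => by
    induction n with
    | zero => rfl
    | succ n ih => rw [Function.iterate_succ', ih, pow_succ']; rfl
  rw [h2, h2, ContinuousLinearMap.fderiv, ContinuousLinearMap.fderiv] at h1
  simpa only [pow_zero, one_apply_eq_self, add_zero] using h1

/-! ### Integral curves of continuous vector fields -/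

section Peano

variable {E : Type*} [NormedAddCommGroup E] [NormedSpace ℝ E]

/-- Euler steps are taken from `p` in both time directions. On a backward step the field is
evaluated at the later vertex, hence the alternative `j = k + 1`. -/
theorem exists_euler_polygon (e : E → E) (p : E) (h : ℝ) : ∃ X : ℤ → E, X 0 = p ∧
    ∀ k, ∃ j, (j = k ∨ j = k + 1) ∧ X (k + 1) = X k + h • e (X j) := by
  refine ⟨fun k => if 0 ≤ k then (fun y => y + h • e y)^[k.toNat] p
    else (fun y => y - h • e y)^[(-k).toNat] p, by simp, fun k => ?_⟩
  rcases lt_trichotomy k (-1) with hk | rfl | hk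
  · refine ⟨k + 1, Or.inr rfl, ?_⟩
    have h1 : ¬ 0 ≤ k := by omega
    have h2 : ¬ 0 ≤ k + 1 := by omega
    have h3 : (-k).toNat = (-(k + 1)).toNat + 1 := by omega
    simp only [h1, h2, if_false, h3, Function.iterate_succ_apply']
    simp
  · exact ⟨0, Or.inr rfl, by simp⟩
  · refine ⟨k, Or.inl rfl, ?_⟩
    have h1 : 0 ≤ k := by omega
    have h2 : 0 ≤ k + 1 := by omega
    have h3 : (k + 1).toNat = k.toNat + 1 := by omega
    simp only [h1, h2, if_true, h3, Function.iterate_succ_apply']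

/-- Summing the errors of the edges. The choice `w = 0`, `ε = 1` bounds the speed of the polygon; `w
= e (c t)` identifies the derivative of the limit curve. -/
theorem norm_euler_sub_le {e : E → E} {h : ℝ} (hh : 0 ≤ h) {X : ℤ → E}
    (hX : ∀ k, ∃ j, (j = k ∨ j = k + 1) ∧ X (k + 1) = X k + h • e (X j)) {w : E} {ε : ℝ}
    (a b : ℤ) (hw : ∀ k ∈ Set.uIcc a b, ‖e (X k) - w‖ ≤ ε) :
    ‖X b - X a - (((b - a : ℤ) : ℝ) * h) • w‖ ≤ ε * |((b - a : ℤ) : ℝ)| * h := by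
  have key : ∀ a b : ℤ, a ≤ b → (∀ k ∈ Set.Icc a b, ‖e (X k) - w‖ ≤ ε) →
      ‖X b - X a - (((b - a : ℤ) : ℝ) * h) • w‖ ≤ ε * ((b - a : ℤ) : ℝ) * h := by
    intro a b hab
    induction b, hab using Int.leInduction with
    | base => simp
    | succ b hab ih =>
      intro hw
      obtain ⟨j, hj, hXj⟩ := hX b
      have h1 := ih fun k hk => hw k ⟨hk.1, by have := hk.2; omega⟩
      have h2 : ‖e (X j) - w‖ ≤ ε := hw j ⟨by omega, by omega⟩
      have h3 : X (b + 1) - X a - (((b + 1 - a : ℤ) : ℝ) * h) • w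
          = (X b - X a - (((b - a : ℤ) : ℝ) * h) • w) + h • (e (X j) - w) := by
        rw [hXj]
        push_cast
        module
      rw [h3]
      refine (norm_add_le _ _).trans ?_
      rw [norm_smul, Real.norm_of_nonneg hh]
      have h4 : h * ‖e (X j) - w‖ ≤ h * ε := by gcongr
      push_cast at h1 ⊢
      linarith
  rcases le_total a b with hab | hab
  · rw [Set.uIcc_of_le hab] at hw
    have h1 : (0 : ℝ) ≤ ((b - a : ℤ) : ℝ) := by exact_mod_cast sub_nonneg.2 hab
    rw [abs_of_nonneg h1]
    exact key a b hab hw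
  · rw [Set.uIcc_of_ge hab] at hw
    have h1 : (((b - a : ℤ) : ℝ)) ≤ 0 := by exact_mod_cast sub_nonpos.2 hab
    rw [abs_of_nonpos h1]
    have h2 := key b a hab hw
    rw [← norm_neg]
    have h3 : -(X b - X a - (((b - a : ℤ) : ℝ) * h) • w)
        = X a - X b - (((a - b : ℤ) : ℝ) * h) • w := by
      push_cast
      module
    rw [h3]
    push_cast at h2 ⊢
    linarith

/-- Peano's theorem for bounded autonomous vector fields: global integral curves. -/
theorem exists_integral_curve [ProperSpace E] {e : E → E} (he : Continuous e)
    (h1 : ∀ v, ‖e v‖ ≤ 1) (p : E) :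
    ∃ c : ℝ → E, c 0 = p ∧ ∀ t, HasDerivAt c (e (c t)) t := by
  let N : ℕ → ℝ := fun n => (n : ℝ) + 1
  have hN : ∀ n, 0 < N n := fun n => by positivity
  choose X hX0 hX using fun n : ℕ => exists_euler_polygon e p (N n)⁻¹
  let m : ℕ → ℝ → ℤ := fun n t => ⌊N n * t⌋
  have hinv : ∀ n, 0 ≤ (N n)⁻¹ := fun n => (inv_pos.2 (hN n)).le
  have hlip : ∀ n a b, ‖X n b - X n a‖ ≤ |((b - a : ℤ) : ℝ)| * (N n)⁻¹ := by
    intro n a b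
    have := norm_euler_sub_le (hinv n) (hX n) (w := 0) (ε := 1) a b
      (fun k _ => by rw [sub_zero]; exact h1 _)
    simpa using this
  have hm : ∀ n t, |(m n t : ℝ) * (N n)⁻¹ - t| ≤ (N n)⁻¹ := by
    intro n t
    have h2 := Int.floor_le (N n * t)
    have h3 := (Int.lt_floor_add_one (N n * t)).le
    have h4 : (m n t : ℝ) * (N n)⁻¹ - t = (m n t - N n * t) * (N n)⁻¹ := by
      have := (hN n).ne'
      field_simp
    rw [h4, abs_mul, abs_of_pos (inv_pos.2 (hN n))]
    refine mul_le_of_le_one_left (hinv n) (abs_le.2 ⟨?_, ?_⟩) <;> simp only [m] <;> linarith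
  have hNlim : Tendsto (fun n => (N n)⁻¹) atTop (𝓝 0) := by
    simpa [N, one_div] using tendsto_one_div_add_atTop_nhds_zero_nat (𝕜 := ℝ)
  have hN1 : ∀ n, (N n)⁻¹ ≤ 1 := fun n => inv_le_one_of_one_le₀ (by simp [N])
  -- Limits along one ultrafilter exist at all times simultaneously, which replaces the
  -- Arzelà–Ascoli theorem.
  let U : Ultrafilter ℕ := hyperfilter ℕ
  have hU : (U : Filter ℕ) ≤ atTop := Nat.hyperfilter_le_atTop
  have hlim : ∀ t, ∃ x, Tendsto (fun n => X n (m n t)) U (𝓝 x) := by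
    intro t
    have hcp := isCompact_closedBall p (|t| + 1)
    obtain ⟨x, -, hx⟩ := hcp.ultrafilter_le_nhds (U.map fun n => X n (m n t)) (by
      rw [Ultrafilter.coe_map]
      refine le_principal_iff.2 (Filter.mem_map.2 (Filter.univ_mem' fun n => ?_))
      have h2 := hlip n 0 (m n t)
      have h3 := hm n t
      rw [hX0, sub_zero] at h2
      rw [Set.mem_preimage, mem_closedBall_iff_norm]
      refine h2.trans ?_
      rw [← abs_of_nonneg (hinv n), ← abs_mul]
      rw [← abs_of_nonneg (hinv n)] at h3
      have h4 := abs_sub_abs_le_abs_sub ((m n t : ℝ) * (N n)⁻¹) t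
      have h5 := hN1 n
      rw [abs_of_nonneg (hinv n)] at *
      linarith)
    exact ⟨x, hx⟩
  choose c hc using hlim
  have hmlim : ∀ t, Tendsto (fun n => (m n t : ℝ) * (N n)⁻¹) U (𝓝 t) := by
    intro t
    refine tendsto_iff_norm_sub_tendsto_zero.2 (squeeze_zero (fun _ => norm_nonneg _)
      (fun n => hm n t) (hNlim.mono_left hU))
  refine ⟨c, ?_, fun t => ?_⟩
  · refine tendsto_nhds_unique (hc 0) ?_
    simp [m, hX0]
  rw [hasDerivAt_iff_isLittleO, Asymptotics.isLittleO_iff]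
  intro ε hε
  obtain ⟨η, hη, hcont⟩ := Metric.continuousAt_iff.1 (he.continuousAt (x := c t)) ε hε
  filter_upwards [Metric.ball_mem_nhds t (by positivity : (0 : ℝ) < η / 3)] with s hs
  rw [Metric.mem_ball, Real.dist_eq] at hs
  -- All vertices between times `t` and `s` eventually lie within `η` of `c t`, where the field is
  -- `ε`-close to `e (c t)`.
  have hev : ∀ᶠ n in U, ‖X n (m n s) - X n (m n t)
      - (((m n s - m n t : ℤ) : ℝ) * (N n)⁻¹) • e (c t)‖
      ≤ ε * |((m n s - m n t : ℤ) : ℝ)| * (N n)⁻¹ := by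
    have ev1 : ∀ᶠ n in U, dist (X n (m n t)) (c t) < η / 3 :=
      (hc t).eventually (Metric.ball_mem_nhds _ (by positivity))
    have ev2 : ∀ᶠ n in U, (N n)⁻¹ < (η / 3 - |s - t|) / 2 :=
      (hNlim.mono_left hU).eventually (gt_mem_nhds (by linarith))
    filter_upwards [ev1, ev2] with n hn1 hn2
    refine norm_euler_sub_le (hinv n) (hX n) _ _ fun k hk => ?_
    rw [← dist_eq_norm]
    refine (hcont ?_).le
    have h2 := hlip n (m n t) k
    have h3 : |((k - m n t : ℤ) : ℝ)| ≤ |((m n s - m n t : ℤ) : ℝ)| := by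
      exact_mod_cast Set.abs_sub_left_of_mem_uIcc hk
    have h4 : |((m n s - m n t : ℤ) : ℝ)| * (N n)⁻¹ ≤ |s - t| + 2 * (N n)⁻¹ := by
      have hs1 := abs_le.1 (hm n s)
      have ht1 := abs_le.1 (hm n t)
      have e1 : |((m n s - m n t : ℤ) : ℝ)| * (N n)⁻¹
          = |(m n s : ℝ) * (N n)⁻¹ - m n t * (N n)⁻¹| := by
        rw [← sub_mul, abs_mul, abs_of_nonneg (hinv n)]
        push_cast
        rfl
      rw [e1, abs_le]
      have := abs_le.1 (le_refl |s - t|)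
      constructor <;> linarith
    have h5 : |((k - m n t : ℤ) : ℝ)| * (N n)⁻¹ ≤ |((m n s - m n t : ℤ) : ℝ)| * (N n)⁻¹ :=
      mul_le_mul_of_nonneg_right h3 (hinv n)
    have h6 := dist_triangle (X n k) (X n (m n t)) (c t)
    rw [dist_eq_norm (X n k) (X n (m n t))] at h6
    linarith
  have hd : Tendsto (fun n => ((m n s - m n t : ℤ) : ℝ) * (N n)⁻¹) U (𝓝 (s - t)) := by
    have := (hmlim s).sub (hmlim t)
    simpa [sub_mul] using this
  refine le_of_tendsto_of_tendsto (((hc s).sub (hc t)).sub (hd.smul_const _)).norm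
    (hd.norm.const_mul ε) (hev.mono fun n hn => hn.trans_eq ?_)
  simp only [Real.norm_eq_abs]
  rw [abs_mul, abs_of_nonneg (hinv n), mul_assoc]

end Peano

/-! ### The unstable line field -/

section UnstableField

variable {φ ψ : Plane → Plane} {K K' r : ℝ}

/-- The pairs of a base point and a tangent vector contracted by all backward iterates. -/
def unstableVectors (ψ : Plane → Plane) (K r : ℝ) : Set (Plane × Plane) :=
  {p | ∀ n : ℕ, ‖fderiv ℝ ψ^[n] p.1 p.2‖ ≤ K * r ^ n * ‖p.2‖}

theorem contDiff_iterate (hψ : ContDiff ℝ 1 ψ) (n : ℕ) : ContDiff ℝ 1 ψ^[n] := by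
  induction n with
  | zero => exact contDiff_id
  | succ n ih => rw [Function.iterate_succ]; exact ih.comp hψ

theorem isClosed_unstableVectors (hψ : ContDiff ℝ 1 ψ) : IsClosed (unstableVectors ψ K r) := by
  rw [unstableVectors, Set.ofPred_forall]
  refine isClosed_iInter fun n => isClosed_le ?_ (by fun_prop)
  exact ((contDiff_iterate hψ n).continuous_fderiv_apply one_ne_zero).norm

/-- Push a growing vector at `ψ^[n] v` forward to `v` and normalise: the first `n` backward iterates
contract it. A limit as `n → ∞` on the compact unit circle is contracted by all of them. -/
theorem exists_unit_mem_unstableVectors (hφ : ContDiff ℝ 1 φ) (hψ : ContDiff ℝ 1 ψ)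
    (hψφ : Function.LeftInverse ψ φ) (hφψ : Function.LeftInverse φ ψ) (h : HasGrowth K r φ)
    (v : Plane) : ∃ w, ‖w‖ = 1 ∧ (v, w) ∈ unstableVectors ψ K r := by
  have hfin : ∀ n : ℕ, ∃ u : Plane, u ∈ Metric.sphere (0 : Plane) 1 ∧
      ∀ k ≤ n, ‖fderiv ℝ ψ^[k] v u‖ ≤ K * r ^ k := by
    intro n
    obtain ⟨w, hw, hgr⟩ := h (ψ^[n] v)
    have hbase : φ^[n] (ψ^[n] v) = v := hφψ.iterate n v
    obtain ⟨W, hW⟩ : ∃ W, W = fderiv ℝ φ^[n] (ψ^[n] v) w := ⟨_, rfl⟩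
    have hW0 : W ≠ 0 := by
      intro h0
      have := hgr 0 n
      rw [add_zero, ← hW, h0, norm_zero, mul_zero] at this
      simp at this
      exact hw this
    have hWpos : 0 < ‖W‖ := norm_pos_iff.2 hW0
    refine ⟨‖W‖⁻¹ • W, by simp [norm_smul, hWpos.ne'], fun k hk => ?_⟩
    obtain ⟨i, rfl⟩ := Nat.exists_eq_add_of_le hk
    have hcomp : ψ^[k] ∘ φ^[k + i] = φ^[i] := by
      rw [Function.iterate_add, ← Function.comp_assoc, (hψφ.iterate k).comp_eq_id,
        Function.id_comp]
    have hder : fderiv ℝ ψ^[k] v W = fderiv ℝ φ^[i] (ψ^[k + i] v) w := by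
      rw [← hcomp, fderiv_comp _ (((hψ.differentiable one_ne_zero).iterate k) _)
        (((hφ.differentiable one_ne_zero).iterate (k + i)) _), hbase, hW]
      rfl
    have h2 := hgr i k
    rw [← hW] at h2
    rw [map_smul, norm_smul, hder, norm_inv, norm_norm, inv_mul_le_iff₀ hWpos, mul_comm]
    exact h2
  choose u hu hu2 using hfin
  obtain ⟨w, hw, θ, hθ, hlim⟩ := (isCompact_sphere (0 : Plane) 1).tendsto_subseq hu
  have hw1 : ‖w‖ = 1 := by simpa using hw
  refine ⟨w, hw1, fun k => ?_⟩
  rw [hw1, mul_one]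
  refine le_of_tendsto (((fderiv ℝ ψ^[k] v).continuous.tendsto w).comp hlim).norm ?_
  filter_upwards [hθ.tendsto_atTop.eventually_ge_atTop k] with j hj
  exact hu2 _ k hj

/-- Two independent such vectors would span the plane, so `ψ` would contract every vector at `v`,
including the one that it expands by `HasGrowth`. -/
theorem eq_or_eq_neg_of_mem_unstableVectors (hr0 : 0 ≤ r) (hr : r < 1)
    (h : HasGrowth K' r ψ) (hK : 0 ≤ K') {v z z' : Plane} (hz : (v, z) ∈ unstableVectors ψ K r)
    (hz' : (v, z') ∈ unstableVectors ψ K r) (hz1 : ‖z‖ = 1) (hz1' : ‖z'‖ = 1) :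
    z' = z ∨ z' = -z := by
  have hs : z 0 ^ 2 + z 1 ^ 2 = 1 := by
    have := EuclideanSpace.norm_sq_eq z
    rw [hz1, Fin.sum_univ_two] at this
    simpa using this.symm
  have hs' : z' 0 ^ 2 + z' 1 ^ 2 = 1 := by
    have := EuclideanSpace.norm_sq_eq z'
    rw [hz1', Fin.sum_univ_two] at this
    simpa using this.symm
  by_cases hdet : z 0 * z' 1 - z 1 * z' 0 = 0
  · have hdot : (z 0 * z' 0 + z 1 * z' 1 - 1) * (z 0 * z' 0 + z 1 * z' 1 + 1) = 0 := by
      linear_combination (z' 0 ^ 2 + z' 1 ^ 2) * hs + hs' - (z 0 * z' 1 - z 1 * z' 0) * hdet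
    rcases mul_eq_zero.1 hdot with h1 | h1
    · left
      ext i
      fin_cases i
      · simp; linear_combination (-z' 0) * hs + z 0 * h1 - z 1 * hdet
      · simp; linear_combination (-z' 1) * hs + z 1 * h1 + z 0 * hdet
    · right
      ext i
      fin_cases i
      · simp; linear_combination (-z' 0) * hs + z 0 * h1 - z 1 * hdet
      · simp; linear_combination (-z' 1) * hs + z 1 * h1 + z 0 * hdet
  · exfalso
    obtain ⟨w, hw, hgr⟩ := h v
    obtain ⟨a, b, hab⟩ : ∃ a b : ℝ, w = a • z + b • z' := by
      obtain ⟨d, hd⟩ : ∃ d, d = z 0 * z' 1 - z 1 * z' 0 := ⟨_, rfl⟩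
      rw [← hd] at hdet
      refine ⟨(w 0 * z' 1 - w 1 * z' 0) / d, (z 0 * w 1 - z 1 * w 0) / d, ?_⟩
      ext i
      fin_cases i <;> simp <;> field_simp <;> rw [hd] <;> ring
    have hle : ∀ n : ℕ, ‖w‖ ≤ K' * K * (|a| + |b|) * ((r ^ 2) ^ n) := by
      intro n
      have h1 := hgr 0 n
      simp only [Function.iterate_zero, add_zero, fderiv_id, ContinuousLinearMap.id_apply] at h1
      refine h1.trans ?_
      have h2 := hz n
      have h3 := hz' n
      simp only [hz1, hz1', mul_one] at h2 h3
      have h4 : ‖fderiv ℝ ψ^[n] v w‖ ≤ |a| * (K * r ^ n) + |b| * (K * r ^ n) := by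
        rw [hab, map_add, map_smul, map_smul]
        refine (norm_add_le _ _).trans ?_
        rw [norm_smul, norm_smul, Real.norm_eq_abs, Real.norm_eq_abs]
        gcongr
      calc K' * r ^ n * ‖fderiv ℝ ψ^[n] v w‖
          ≤ K' * r ^ n * (|a| * (K * r ^ n) + |b| * (K * r ^ n)) := by gcongr
        _ = _ := by rw [← pow_mul]; ring
    have hlim := (tendsto_pow_atTop_nhds_zero_of_lt_one (pow_nonneg hr0 2)
      (pow_lt_one₀ hr0 hr two_ne_zero)).const_mul (K' * K * (|a| + |b|))
    rw [mul_zero] at hlim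
    exact hw (norm_le_zero_iff.1 (ge_of_tendsto' hlim hle))

/-- The unstable line field is spanned by a continuous unit vector field. -/
theorem exists_unit_field (hφ : ContDiff ℝ 1 φ) (hψ : ContDiff ℝ 1 ψ)
    (hψφ : Function.LeftInverse ψ φ) (hφψ : Function.LeftInverse φ ψ) (hr0 : 0 ≤ r) (hr : r < 1)
    (h : HasGrowth K r φ) (hK' : 0 ≤ K') (h' : HasGrowth K' r ψ) :
    ∃ e : Plane → Plane, Continuous e ∧ (∀ v, ‖e v‖ = 1) ∧
      ∀ v (n : ℕ), ‖fderiv ℝ ψ^[n] v (e v)‖ ≤ K * r ^ n := by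
  choose z hz1 hzm using exists_unit_mem_unstableVectors hφ hψ hψφ hφψ h
  -- The unit vectors `z v` are defined only up to sign, so their squares in `ℂ` are well defined.
  -- Closedness of `unstableVectors` makes the squares continuous in `v`; their angle lifts over the
  -- plane, and half of it gives a continuous choice of sign.
  let toC : Plane → ℂ := fun w => ⟨w 0, w 1⟩
  have htoC : Continuous toC := by
    have : toC = fun w : Plane => (w 0 : ℂ) + (w 1 : ℂ) * Complex.I := by
      funext w
      exact Complex.mk_eq_add_mul_I _ _
    rw [this]
    fun_prop
  have hnorm : ∀ w, ‖toC w‖ = ‖w‖ := by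
    intro w
    rw [EuclideanSpace.norm_eq, Fin.sum_univ_two, Complex.norm_eq_sqrt_sq_add_sq]
    simp [toC]
  have hinj : Function.Injective toC := by
    intro a b hab
    ext i
    fin_cases i
    · exact congrArg Complex.re hab
    · exact congrArg Complex.im hab
  have hneg : ∀ w, toC (-w) = -toC w := by
    intro w
    apply Complex.ext <;> simp [toC]
  have hq : Continuous fun v => toC (z v) ^ 2 := by
    refine continuous_iff_ultrafilter.2 fun v U hU => ?_
    obtain ⟨w, hw, hlim⟩ := (isCompact_sphere (0 : Plane) 1).ultrafilter_le_nhds (U.map z)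
      (by
        rw [Ultrafilter.coe_map]
        exact le_principal_iff.2 (Filter.mem_map.2 (Filter.univ_mem' fun x => by simp [hz1])))
    have hlim' : Tendsto z U (𝓝 w) := hlim
    have hw1 : ‖w‖ = 1 := by simpa using hw
    have hmem : (v, w) ∈ unstableVectors ψ K r :=
      (isClosed_unstableVectors hψ).mem_of_tendsto
        ((show Tendsto id (U : Filter Plane) (𝓝 v) from hU).prodMk_nhds hlim')
        (Eventually.of_forall hzm)
    have hpm := eq_or_eq_neg_of_mem_unstableVectors hr0 hr h' hK' (hzm v) hmem (hz1 v) hw1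
    have hsq : toC (z v) ^ 2 = toC w ^ 2 := by
      rcases hpm with rfl | rfl
      · rfl
      · rw [hneg, neg_sq]
    rw [hsq]
    exact ((htoC.pow 2).tendsto w).comp hlim'
  have hcirc : ∀ v, toC (z v) ^ 2 ∈ Submonoid.unitSphere ℂ := fun v => by
    rw [Submonoid.unitSphere, ← SetLike.mem_coe]
    simp [hnorm, hz1]
  let q : C(Plane, Circle) := ⟨fun v => ⟨toC (z v) ^ 2, hcirc v⟩, hq.subtype_mk hcirc⟩
  obtain ⟨θ, ⟨-, hθ⟩, -⟩ := Circle.isCoveringMap_exp.existsUnique_continuousMap_lifts q 0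
    (Complex.arg (q 0)) (Circle.exp_arg (q 0))
  let e : Plane → Plane := fun v => WithLp.toLp 2 ![Real.cos (θ v / 2), Real.sin (θ v / 2)]
  have he : ∀ v, e v = z v ∨ e v = -z v := by
    intro v
    have h1 : toC (e v) = Complex.exp ((θ v / 2 : ℝ) * Complex.I) := by
      rw [Complex.exp_mul_I]
      apply Complex.ext <;> simp [toC, e, ← Complex.ofReal_cos, ← Complex.ofReal_sin,
        -Complex.ofReal_div]
    have h2 : toC (e v) ^ 2 = toC (z v) ^ 2 := by
      have h3 : ((Circle.exp (θ v) : Circle) : ℂ) = toC (z v) ^ 2 :=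
        congrArg (fun c : Circle => (c : ℂ)) (congrFun hθ v)
      rw [← h3, h1, ← Complex.exp_nat_mul, Circle.coe_exp]
      congr 1
      push_cast
      ring
    rcases sq_eq_sq_iff_eq_or_eq_neg.1 h2 with h4 | h4
    · exact Or.inl (hinj h4)
    · exact Or.inr (hinj (h4.trans (hneg _).symm))
  refine ⟨e, ?_, fun v => ?_, fun v n => ?_⟩
  · refine (PiLp.continuous_toLp 2 _).comp (continuous_pi fun i => ?_)
    fin_cases i
    · simp; fun_prop
    · simp; fun_prop
  · rcases he v with h1 | h1 <;> simp [h1, hz1]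
  · have h2 := hzm v n
    simp only [hz1, mul_one] at h2
    rcases he v with h1 | h1
    · rwa [h1]
    · rwa [h1, map_neg, norm_neg]

theorem norm_iterate_sub_le_of_integral_curve (hψ : ContDiff ℝ 1 ψ) {e : Plane → Plane}
    (he : ∀ v (n : ℕ), ‖fderiv ℝ ψ^[n] v (e v)‖ ≤ K * r ^ n) {c : ℝ → Plane}
    (hc : ∀ t, HasDerivAt c (e (c t)) t) (n : ℕ) (s t : ℝ) :
    ‖ψ^[n] (c s) - ψ^[n] (c t)‖ ≤ K * r ^ n * |s - t| := by
  have hd : ∀ x ∈ (Set.univ : Set ℝ), HasDerivWithinAt (fun x => ψ^[n] (c x))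
      (fderiv ℝ ψ^[n] (c x) (e (c x))) Set.univ x := fun x _ =>
    (((((hψ.differentiable one_ne_zero).iterate n) (c x)).hasFDerivAt.comp_hasDerivAt x
      (hc x))).hasDerivWithinAt
  exact convex_univ.norm_image_sub_le_of_norm_hasDerivWithin_le hd (fun x _ => he _ _)
    (Set.mem_univ t) (Set.mem_univ s)

end UnstableField

/-! ### Lifts of maps homotopic to the identity -/

/-- The lift to the plane of the map `x ↦ x + proj (D x)` of the torus. -/
def dispLift (D : C(Torus, Plane)) (v : Plane) : Plane := v + D (proj v)

theorem continuous_dispLift (D : C(Torus, Plane)) : Continuous (dispLift D) :=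
  continuous_id.add (D.continuous.comp continuous_proj)

theorem proj_dispLift {D : C(Torus, Plane)} {h : Torus → Torus} (hD : ∀ x, h x = x + proj (D x))
    (v : Plane) : proj (dispLift D v) = h (proj v) := by
  rw [dispLift, proj_add, hD]

theorem dispLift_add_intVec (D : C(Torus, Plane)) (v : Plane) (k : Fin 2 → ℤ) :
    dispLift D (v + intVec k) = dispLift D v + intVec k := by
  rw [dispLift, dispLift, proj_add_intVec, add_right_comm]

theorem injective_dispLift {D : C(Torus, Plane)} {h : Torus → Torus}
    (hD : ∀ x, h x = x + proj (D x)) (hi : Function.Injective h) :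
    Function.Injective (dispLift D) := by
  intro v w hvw
  have h1 : proj v = proj w := hi (by rw [← proj_dispLift hD, ← proj_dispLift hD, hvw])
  have h2 := hvw
  rw [dispLift, dispLift, h1] at h2
  exact add_right_cancel h2

theorem surjective_dispLift {D : C(Torus, Plane)} {h : Torus → Torus}
    (hD : ∀ x, h x = x + proj (D x)) (hs : Function.Surjective h) :
    Function.Surjective (dispLift D) := by
  intro u
  obtain ⟨x, hx⟩ := hs (proj u)
  obtain ⟨v, rfl⟩ := proj_surjective x
  rw [← proj_dispLift hD, eq_comm] at hx
  obtain ⟨k, hk⟩ := proj_eq_proj_iff.1 hx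
  exact ⟨v + intVec k, by rw [dispLift_add_intVec, hk]⟩

/-- A relation on the torus lifts to the plane up to a lattice vector, which is constant by
connectedness and disappears in differences. -/
theorem dispLift_sub_of_semiconj {D D' : C(Torus, Plane)} {h h' f : Torus → Torus}
    {φ : Plane → Plane} {A : Matrix (Fin 2) (Fin 2) ℤ} (hD : ∀ x, h x = x + proj (D x))
    (hD' : ∀ x, h' x = x + proj (D' x)) (hφ : Continuous φ)
    (hl : ∀ v, proj (φ v) = f (proj v)) (hc : ∀ x, h' (f x) = toralMap A (h x)) (v w : Plane) :
    dispLift D' (φ v) - dispLift D' (φ w) = planeMap A (dispLift D v - dispLift D w) := by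
  have := eq_of_forall_proj_eq_zero
    (δ := fun v => dispLift D' (φ v) - planeMap A (dispLift D v))
    (((continuous_dispLift D').comp hφ).sub
      ((planeMap A).continuous.comp (continuous_dispLift D)))
    (fun x => by
      rw [proj_sub, proj_dispLift hD', proj_planeMap, proj_dispLift hD, hl, hc, sub_self]) v w
  rw [map_sub, sub_eq_sub_iff_sub_eq_sub]
  exact this

/-- Iterates of `dispLift_sub_of_semiconj` along a sequence of semiconjugacies. -/
theorem dispLift_sub_iterate {D : ℕ → C(Torus, Plane)} {h : ℕ → Torus → Torus} {f : Torus → Torus}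
    {φ : Plane → Plane} {A : Matrix (Fin 2) (Fin 2) ℤ}
    (hD : ∀ n x, h n x = x + proj (D n x)) (hφ : Continuous φ)
    (hl : ∀ v, proj (φ v) = f (proj v)) (hc : ∀ n x, h n (f x) = toralMap A (h (n + 1) x))
    (n m : ℕ) (v w : Plane) :
    dispLift (D m) (φ^[n] v) - dispLift (D m) (φ^[n] w)
      = (planeMap A ^ n) (dispLift (D (m + n)) v - dispLift (D (m + n)) w) := by
  induction n generalizing m with
  | zero => simp
  | succ n ih =>
    rw [Function.iterate_succ_apply', Function.iterate_succ_apply',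
      dispLift_sub_of_semiconj (hD (m + 1)) (hD m) hφ hl (hc m), ih, pow_succ',
      mul_apply_eq_comp, add_right_comm, add_assoc m n 1]

/-! ### Linear leaves and periodic points -/

/-- A subgroup of `ℝ` is dense or cyclic. If it were cyclic, the values on the two basis vectors
would be commensurable, which puts a nonzero lattice vector on the unstable line. -/
theorem HyperbolicSplitting.dense_range_ℓs {A : GL (Fin 2) ℤ}
    (S : HyperbolicSplitting (planeMap A.val)) : DenseRange fun k => S.ℓs (intVec k) := by
  let F : (Fin 2 → ℤ) →+ ℝ :=
    { toFun := fun k => S.ℓs (intVec k)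
      map_zero' := by
        have : intVec 0 = 0 := by ext i; simp
        rw [this, map_zero]
      map_add' := fun k l => by
        have : intVec (k + l) = intVec k + intVec l := by ext i; simp
        rw [this, map_add] }
  have hr : Set.range (fun k => S.ℓs (intVec k)) = (F.range : Set ℝ) := rfl
  rw [DenseRange, hr]
  rcases F.range.dense_or_cyclic with hd | ⟨a, ha⟩
  · exact hd
  exfalso
  have hmem : ∀ k, ∃ n : ℤ, n • a = F k := by
    intro k
    have : F k ∈ F.range := ⟨k, rfl⟩
    rw [ha] at this
    exact AddSubgroup.mem_closure_singleton.1 this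
  obtain ⟨m, hm⟩ := hmem (Pi.single 0 1)
  obtain ⟨n, hn⟩ := hmem (Pi.single 1 1)
  have h0 : F (n • Pi.single 0 1 - m • Pi.single 1 1) = 0 := by
    rw [map_sub, map_zsmul, map_zsmul, ← hm, ← hn, smul_smul, smul_smul, mul_comm, sub_self]
  have h1 := S.ℓs_intVec_ne h0
  have hn0 : n = 0 := by simpa using congrFun h1 0
  rw [hn0, zero_smul] at hn
  have h2 := S.ℓs_intVec_ne hn.symm
  simpa using congrFun h2 1

/-- The leaves of the linear unstable foliation are dense. -/
theorem HyperbolicSplitting.denseRange_leaf {A : GL (Fin 2) ℤ}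
    (S : HyperbolicSplitting (planeMap A.val)) (p : Plane) :
    DenseRange fun t : ℝ => proj (p + t • S.vu) := by
  intro x
  obtain ⟨v, rfl⟩ := proj_surjective x
  rw [Metric.mem_closure_range_iff]
  intro ε hε
  have hpos : 0 < ε / (‖S.vs‖ + 1) := by positivity
  obtain ⟨k, hk⟩ := Metric.denseRange_iff.1 S.dense_range_ℓs (S.ℓs (v - p)) _ hpos
  refine ⟨S.ℓu (v - p - intVec k), ?_⟩
  rw [← proj_add_intVec (p + _) k]
  refine (dist_proj_le _ _).trans_lt ?_
  have h1 : v - (p + S.ℓu (v - p - intVec k) • S.vu + intVec k)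
      = S.ℓs (v - p - intVec k) • S.vs := by
    have := sub_eq_of_eq_add' (S.decomp (v - p - intVec k))
    rw [← this]
    abel
  rw [h1, norm_smul, map_sub]
  rw [Real.dist_eq, lt_div_iff₀ (by positivity)] at hk
  refine lt_of_le_of_lt ?_ hk
  rw [Real.norm_eq_abs]
  gcongr
  linarith

/-- Some power of an integer invertible matrix fixes a given point of finite order. -/
theorem exists_pow_toralMap_eq (A : GL (Fin 2) ℤ) {q : Torus} {N : ℕ} (hN : 0 < N)
    (hq : N • q = 0) : ∃ k, 0 < k ∧ toralMap (A.val ^ k) q = q := by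
  have : NeZero N := ⟨hN.ne'⟩
  -- Some power of `A` is the identity modulo `N`, since the group over `ZMod N` is finite, and
  -- multiples of `N` kill `q`.
  let R := Matrix.GeneralLinearGroup.map (n := Fin 2) (Int.castRingHom (ZMod N))
  obtain ⟨k, hk, hk1⟩ := (isOfFinOrder_of_finite (R A)).exists_pow_eq_one
  refine ⟨k, hk, ?_⟩
  have hent : ∀ i j, ∃ c : ℤ, (A.val ^ k) i j = (1 : Matrix (Fin 2) (Fin 2) ℤ) i j + c * N := by
    intro i j
    have h1 : ((A.val ^ k) i j : ZMod N) = ((1 : Matrix (Fin 2) (Fin 2) ℤ) i j : ℤ) := by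
      rw [← map_pow] at hk1
      have h2 := congrArg (fun B : GL (Fin 2) (ZMod N) => B.val i j) hk1
      have h3 : (R (A ^ k)).val i j = (((A.val ^ k) i j : ℤ) : ZMod N) := by
        change (Int.castRingHom (ZMod N)) ((A ^ k).val i j) = _
        rw [Units.val_pow_eq_pow_val]
        rfl
      rw [← h3, h2]
      by_cases hij : i = j <;> simp [Matrix.one_apply, hij]
    obtain ⟨c, hc⟩ := (ZMod.intCast_eq_intCast_iff_dvd_sub _ _ _).1 h1.symm
    exact ⟨c, by linarith⟩
  choose c hc using hent
  have hz : ∀ (m : ℤ) j, (m * N) • q j = 0 := by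
    intro m j
    have : N • q j = 0 := congrFun hq j
    rw [mul_smul, natCast_zsmul, this, smul_zero]
  funext i
  have hone := congrFun (toralMap_one q) i
  simp only [toralMap, ContinuousMap.coe_mk, Fin.sum_univ_two] at hone ⊢
  rw [hc, hc, add_smul, add_smul, hz, hz, add_zero, add_zero]
  exact hone

theorem conj_iterate {A : Matrix (Fin 2) (Fin 2) ℤ} {f h : Torus → Torus}
    (hc : ∀ x, h (f x) = toralMap A (h x)) (n : ℕ) (x : Torus) :
    h (f^[n] x) = toralMap (A ^ n) (h x) := by
  induction n with
  | zero => simp [toralMap_one]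
  | succ n ih => rw [Function.iterate_succ_apply', hc, ih, toralMap_mul, ← pow_succ']

/-- Periodic points of a map conjugate to a toral automorphism are dense. -/
theorem exists_periodic_mem {A : GL (Fin 2) ℤ} {f : Torus → Torus} (h : Torus ≃ₜ Torus)
    (hc : ∀ x, h (f x) = toralMap A.val (h x)) {U : Set Torus} (hU : IsOpen U)
    (hne : U.Nonempty) : ∃ x ∈ U, ∃ k, 0 < k ∧ f^[k] x = x := by
  obtain ⟨q, ⟨x, hx, rfl⟩, N, hN, hq⟩ :=
    exists_finite_order_mem (h.isOpenMap U hU) (hne.image h)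
  obtain ⟨k, hk, hk1⟩ := exists_pow_toralMap_eq A hN hq
  exact ⟨x, hx, k, hk, h.injective (by rw [conj_iterate hc, hk1])⟩

/-- A quantitative local surjectivity of functions with nonzero derivative. -/
theorem exists_preimage_of_hasDerivAt_ne_zero {b : ℝ → ℝ} {β : ℝ} (hb : Continuous b)
    (h0 : b 0 = 0) (hd : HasDerivAt b β 0) (hβ : β ≠ 0) :
    ∃ ρ > 0, ∃ C, ∀ x, |x| ≤ ρ → ∃ s, b s = x ∧ |s| ≤ C * |x| := by
  have hβ' : 0 < |β| := abs_pos.2 hβ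
  rw [hasDerivAt_iff_isLittleO, Asymptotics.isLittleO_iff] at hd
  obtain ⟨δ, hδ, hball⟩ := Metric.eventually_nhds_iff.1 (hd (half_pos hβ'))
  have hest : ∀ s, |s| < δ → |b s - s * β| ≤ |β| / 2 * |s| := by
    intro s hs
    have := hball (y := s) (by simpa [Real.dist_eq] using hs)
    simpa [h0] using this
  have hlow : ∀ s, |s| < δ → |β| / 2 * |s| ≤ |b s| := by
    intro s hs
    have h1 := hest s hs
    have h2 := abs_sub_abs_le_abs_sub (s * β) (b s)
    rw [abs_sub_comm, abs_mul] at h2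
    linarith
  -- The values `b (±δ / 2)` lie on opposite sides of `0`, at distance at least `|β| * δ / 4`; the
  -- constant `2 / |β|` inverts `hlow`.
  refine ⟨|β| * δ / 4, by positivity, 2 / |β|, fun x hx => ?_⟩
  have hmem : x ∈ Set.uIcc (b (-(δ / 2))) (b (δ / 2)) := by
    have hδ2 : |δ / 2| = δ / 2 := abs_of_pos (by positivity)
    have h1 := hest (δ / 2) (by rw [hδ2]; linarith)
    have h2 := hest (-(δ / 2)) (by rw [abs_neg, hδ2]; linarith)
    rw [abs_neg, hδ2] at h2
    rw [hδ2] at h1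
    rw [abs_le] at h1 h2 hx
    rcases abs_cases β with ⟨hb1, -⟩ | ⟨hb1, -⟩ <;> rw [hb1] at h1 h2 hx <;> rw [Set.mem_uIcc]
    · left; constructor <;> nlinarith
    · right; constructor <;> nlinarith
  obtain ⟨s, hs, hsx⟩ := intermediate_value_uIcc hb.continuousOn hmem
  refine ⟨s, hsx, ?_⟩
  have hs' : |s| < δ := by
    rw [Set.uIcc_of_le (by linarith)] at hs
    exact abs_lt.2 ⟨by linarith [hs.1], by linarith [hs.2]⟩
  have := hlow s hs'
  rw [hsx] at this
  rw [div_mul_eq_mul_div, le_div_iff₀ hβ']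
  linarith

/-! ### Rigidity of the displacement along the unstable foliation -/

/-- The lift of a conjugacy to a hyperbolic automorphism maps integral curves of the unstable field
into unstable lines. -/
theorem HyperbolicSplitting.ℓs_dispLift_sub_eq_zero {A : GL (Fin 2) ℤ}
    (S : HyperbolicSplitting (planeMap A.val)) {f h : Torus → Torus} {D : C(Torus, Plane)}
    (hD : ∀ x, h x = x + proj (D x)) (hc : ∀ x, h (f x) = toralMap A.val (h x))
    {φ ψ : Plane → Plane} (hφ : Continuous φ) (hl : ∀ v, proj (φ v) = f (proj v))
    (hφψ : Function.LeftInverse φ ψ) {v w : Plane} {B : ℝ}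
    (hB : ∀ n : ℕ, ‖ψ^[n] v - ψ^[n] w‖ ≤ B) : S.ℓs (dispLift D v - dispLift D w) = 0 := by
  -- The lift of `h` is at bounded distance from the identity, so bounded backward separation of `v`
  -- and `w` bounds the backward linear orbit of the difference of their images.
  refine S.ℓs_eq_zero_of_bounded (B := B + (‖D‖ + ‖D‖)) fun n =>
    ⟨dispLift D (ψ^[n] v) - dispLift D (ψ^[n] w), ?_, ?_⟩
  · have := dispLift_sub_iterate (D := fun _ => D) (h := fun _ => h) (fun _ => hD) hφ hl
      (fun _ => hc) n 0 (ψ^[n] v) (ψ^[n] w)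
    rw [hφψ.iterate n v, hφψ.iterate n w] at this
    exact this.symm
  · have : dispLift D (ψ^[n] v) - dispLift D (ψ^[n] w)
        = (ψ^[n] v - ψ^[n] w) + (D (proj (ψ^[n] v)) - D (proj (ψ^[n] w))) := by
      simp only [dispLift]
      abel
    rw [this]
    refine (norm_add_le _ _).trans (add_le_add (hB n) ((norm_sub_le _ _).trans ?_))
    exact add_le_add (D.norm_coe_le_norm _) (D.norm_coe_le_norm _)

/-- Semiconjugacies which are asymptotic in the past, in the `C¹` sense along the unstable
foliation, to a conjugacy `h` differ from it by a translation. -/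
theorem exists_displacement_eq_add_const {A : GL (Fin 2) ℤ}
    (S : HyperbolicSplitting (planeMap A.val)) {f : Torus → Torus} {φ ψ : Plane → Plane}
    (hφ : Continuous φ) (hψ : ContDiff ℝ 1 ψ) (hl : ∀ v, proj (φ v) = f (proj v))
    (hφψ : Function.LeftInverse φ ψ) {e : Plane → Plane} (he : Continuous e)
    (he1 : ∀ v, ‖e v‖ = 1) {K r : ℝ} (hK : 0 ≤ K) (hr0 : 0 ≤ r) (hr : r < 1)
    (hcontr : ∀ v (n : ℕ), ‖fderiv ℝ ψ^[n] v (e v)‖ ≤ K * r ^ n)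
    (h : Torus ≃ₜ Torus) {D : C(Torus, Plane)} (hD : ∀ x, h x = x + proj (D x))
    (hc : ∀ x, h (f x) = toralMap A.val (h x))
    {h' : ℕ → Torus → Torus} {D' : ℕ → C(Torus, Plane)}
    (hD' : ∀ n x, h' n x = x + proj (D' n x))
    (hc' : ∀ n x, h' n (f x) = toralMap A.val (h' (n + 1) x))
    {G : C(Torus, Plane →L[ℝ] Plane)} {G' : ℕ → C(Torus, Plane →L[ℝ] Plane)}
    (hG : Tendsto G' atTop (𝓝 G))
    (hder : ∀ c : ℝ → Plane, (∀ t, HasDerivAt c (e (c t)) t) →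
      (∀ t, HasDerivAt (fun t => dispLift D (c t)) (G (proj (c t)) (e (c t))) t) ∧
      ∀ n t, HasDerivAt (fun t => dispLift (D' n) (c t)) (G' n (proj (c t)) (e (c t))) t) :
    ∃ a, ∀ x, D' 0 x = D x + a := by
  have hGn : Tendsto (fun n => ‖G' n - G‖) atTop (𝓝 0) := by
    have : Tendsto (fun n => dist (G' n) G) atTop (𝓝 0) := tendsto_iff_dist_tendsto_zero.1 hG
    exact this.congr fun n => dist_eq_norm (G' n) G
  have hinj : Function.Injective (dispLift D) := injective_dispLift hD h.injective
  have hsurj : Function.Surjective (dispLift D) := surjective_dispLift hD h.surjective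
  -- a point where the leafwise derivative does not vanish
  obtain ⟨v₀, hv₀⟩ : ∃ v, G (proj v) (e v) ≠ 0 := by
    by_contra hcon
    push Not at hcon
    obtain ⟨c, -, hcd⟩ := exists_integral_curve he (fun v => (he1 v).le) 0
    have hd0 : ∀ t, HasDerivAt (fun t => dispLift D (c t)) 0 t := fun t => by
      have := (hder c hcd).1 t
      rwa [hcon] at this
    have hconst : ∀ s t, c s = c t := fun s t => hinj
      (is_const_of_deriv_eq_zero (fun t => (hd0 t).differentiableAt) (fun t => (hd0 t).deriv) s t)
    have h1 : HasDerivAt c 0 0 := by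
      have : c = fun _ => c 0 := funext fun s => hconst s 0
      rw [this]
      exact hasDerivAt_const _ _
    have h2 := (hcd 0).unique h1
    have h3 := he1 (c 0)
    rw [h2, norm_zero] at h3
    exact zero_ne_one h3
  -- a periodic such point
  obtain ⟨y, hy, k, hk, hper⟩ : ∃ y, G (proj y) (e y) ≠ 0 ∧ ∃ k, 0 < k ∧
      f^[k] (proj y) = proj y := by
    have hcont : Continuous fun v => G (proj v) (e v) :=
      (G.continuous.comp continuous_proj).clm_apply he
    have ho : IsOpen {v | G (proj v) (e v) ≠ 0} := isOpen_ne_fun hcont continuous_const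
    obtain ⟨-, ⟨y, hy, rfl⟩, k, hk, hper⟩ :=
      exists_periodic_mem h hc (isOpenMap_proj _ ho) ⟨_, v₀, hv₀, rfl⟩
    exact ⟨y, hy, k, hk, hper⟩
  have hiter : ∀ n v, proj (φ^[n] v) = f^[n] (proj v) := by
    intro n v
    induction n with
    | zero => rfl
    | succ n ih => rw [Function.iterate_succ_apply', Function.iterate_succ_apply', hl, ih]
  -- Returning to `y` up to a lattice vector lets the single local inversion of `b` at `y` serve all
  -- times `k * n`.
  have hperiod : ∀ n, ∃ m, φ^[k * n] y = y + intVec m := by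
    intro n
    refine proj_eq_proj_iff.1 ?_
    rw [hiter, Function.iterate_mul]
    exact Function.iterate_fixed hper n
  obtain ⟨c, hc0, hcd⟩ := exists_integral_curve he (fun v => (he1 v).le) y
  obtain ⟨hder1, hder2⟩ := hder c hcd
  let b : ℝ → ℝ := fun t => S.ℓu (dispLift D (c t) - dispLift D y)
  have hb : ∀ t, dispLift D (c t) - dispLift D y = b t • S.vu := by
    intro t
    have hs : S.ℓs (dispLift D (c t) - dispLift D y) = 0 := by
      refine S.ℓs_dispLift_sub_eq_zero hD hc hφ hl hφψ (B := K * 1 * |t - 0|) fun n => ?_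
      rw [← hc0]
      refine (norm_iterate_sub_le_of_integral_curve hψ hcontr hcd n t 0).trans ?_
      gcongr
      exact pow_le_one₀ hr0 hr.le
    have := S.decomp (dispLift D (c t) - dispLift D y)
    rwa [hs, zero_smul, add_zero] at this
  have hbd : ∀ t, HasDerivAt b (S.ℓu (G (proj (c t)) (e (c t)))) t := fun t =>
    S.ℓu.hasFDerivAt.comp_hasDerivAt t ((hder1 t).sub_const _)
  -- The image curve lies on an unstable line, so its velocity is a multiple of `vu` and `ℓu`
  -- detects that it is nonzero.
  have hβ : S.ℓu (G (proj (c 0)) (e (c 0))) ≠ 0 := by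
    intro h0
    have h1 : HasDerivAt (fun t => b t • S.vu) 0 0 := by
      have := (hbd 0).smul_const S.vu
      rwa [h0, zero_smul] at this
    have h2 : HasDerivAt (fun t => b t • S.vu) (G (proj (c 0)) (e (c 0))) 0 := by
      have := (hder1 0).sub_const (dispLift D y)
      exact this.congr_of_eventuallyEq (Eventually.of_forall fun t => (hb t).symm)
    rw [hc0] at h2
    exact hy (h2.unique h1)
  have hb0 : b 0 = 0 := by simp [b, hc0]
  obtain ⟨ρ, hρ, C, hC⟩ := exists_preimage_of_hasDerivAt_ne_zero
    (continuous_iff_continuousAt.2 fun t => (hbd t).continuousAt) hb0 (hbd 0) hβ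
  obtain ⟨C', hC'0, hC'⟩ := S.exists_norm_pow_le
  -- the two displacements agree along the leaf of the periodic point
  have hleaf : ∀ x : ℝ, ∀ z, dispLift D z = dispLift D y + x • S.vu →
      dispLift (D' 0) z - dispLift (D' 0) y = dispLift D z - dispLift D y := by
    intro x z hz
    have hμ1 : |S.μ⁻¹| < 1 := by
      rw [abs_inv]
      exact inv_lt_one_of_one_lt₀ S.one_lt_μ
    have hkn : Tendsto (fun n : ℕ => k * n) atTop atTop :=
      tendsto_id.const_mul_atTop' hk
    have hsmall : ∀ᶠ n : ℕ in atTop, |(S.μ⁻¹) ^ (k * n) * x| ≤ ρ := by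
      have h1 : Tendsto (fun n : ℕ => |S.μ⁻¹| ^ (k * n) * |x|) atTop (𝓝 (0 * |x|)) :=
        ((tendsto_pow_atTop_nhds_zero_of_lt_one (abs_nonneg _) hμ1).comp hkn).mul_const _
      rw [zero_mul] at h1
      filter_upwards [h1.eventually (gt_mem_nhds hρ)] with n hn
      rw [abs_mul, abs_pow]
      exact hn.le
    have hεlim : Tendsto (fun n : ℕ => C' * ‖G' (k * n) - G‖ * (C * |x|)) atTop (𝓝 0) := by
      have h1 := hGn.comp hkn
      have h2 := (h1.const_mul C').mul_const (C * |x|)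
      rwa [mul_zero, zero_mul] at h2
    have hbound : ∀ᶠ n : ℕ in atTop,
        ‖(dispLift (D' 0) z - dispLift (D' 0) y) - (dispLift D z - dispLift D y)‖
          ≤ C' * ‖G' (k * n) - G‖ * (C * |x|) := by
      filter_upwards [hsmall] with n hn
      obtain ⟨s, hs, hsC⟩ := hC _ hn
      obtain ⟨m, hm⟩ := hperiod n
      have hrel := dispLift_sub_iterate (D := fun _ => D) (h := fun _ => h) (fun _ => hD) hφ hl
        (fun _ => hc) (k * n) 0 (c s) y
      have hrel' := dispLift_sub_iterate hD' hφ hl hc' (k * n) 0 (c s) y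
      -- The parameter `s` solves `b s = μ⁻ᵏⁿ x`, so both sides have the same image under the
      -- injective lift of `h`.
      have hzc : z = φ^[k * n] (c s) - intVec m := by
        apply hinj
        have h1 := dispLift_add_intVec D (φ^[k * n] (c s) - intVec m) m
        rw [sub_add_cancel] at h1
        rw [hz, ← sub_eq_iff_eq_add'.2 (h1.trans (add_comm _ _))]
        rw [hb, map_smul, S.pow_vu, hs, smul_smul, hm, dispLift_add_intVec] at hrel
        have h2 : (S.μ⁻¹) ^ (k * n) * x * S.μ ^ (k * n) = x := by
          rw [inv_pow, mul_right_comm, inv_mul_cancel₀ (pow_ne_zero _ S.μ_ne), one_mul]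
        rw [h2] at hrel
        rw [← hrel]
        abel
      have hzd : ∀ E : C(Torus, Plane), dispLift E z - dispLift E y
          = dispLift E (φ^[k * n] (c s)) - dispLift E (φ^[k * n] y) := by
        intro E
        have h1 := dispLift_add_intVec E z m
        rw [hm, dispLift_add_intVec, show φ^[k * n] (c s) = z + intVec m by
          rw [hzc, sub_add_cancel], h1]
        abel
      rw [hzd, hzd, hrel, hrel', zero_add, ← map_sub]
      refine (hC' _ _).trans ?_
      have hmv : ‖(dispLift (D' (k * n)) (c s) - dispLift (D' (k * n)) y)
          - (dispLift D (c s) - dispLift D y)‖ ≤ ‖G' (k * n) - G‖ * |s| := by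
        have hdd : ∀ t ∈ (Set.univ : Set ℝ), HasDerivWithinAt
            (fun t => dispLift (D' (k * n)) (c t) - dispLift D (c t))
            ((G' (k * n) - G) (proj (c t)) (e (c t))) Set.univ t := fun t _ =>
          ((hder2 (k * n) t).sub (hder1 t)).hasDerivWithinAt
        have := convex_univ.norm_image_sub_le_of_norm_hasDerivWithin_le
          (C := ‖G' (k * n) - G‖) hdd (fun t _ => ?_) (Set.mem_univ 0) (Set.mem_univ s)
        · rw [sub_zero, Real.norm_eq_abs, hc0] at this
          rw [sub_sub_sub_comm]
          exact this
        · refine (ContinuousLinearMap.le_opNorm _ _).trans ?_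
          rw [he1, mul_one]
          exact (G' (k * n) - G).norm_coe_le_norm _
      have hμn : 0 < |S.μ| ^ (k * n) := pow_pos (abs_pos.2 S.μ_ne) _
      -- The expansion `|μ| ^ (k * n)` cancels against `|s| ≤ C * |μ|⁻ᵏⁿ * |x|`, leaving only the
      -- convergence of the derivatives.
      calc _ ≤ C' * |S.μ| ^ (k * n) * (‖G' (k * n) - G‖ * |s|) := by gcongr
        _ ≤ C' * |S.μ| ^ (k * n) * (‖G' (k * n) - G‖ * (C * |(S.μ⁻¹) ^ (k * n) * x|)) := by
          gcongr
        _ = _ := by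
          rw [abs_mul, abs_pow, abs_inv, inv_pow]
          field_simp
    exact sub_eq_zero.1 (norm_le_zero_iff.1 (ge_of_tendsto hεlim hbound))
  -- hence everywhere, by density
  refine ⟨D' 0 (proj y) - D (proj y), fun x => ?_⟩
  let T : Set Torus := {x | D' 0 x = D x + (D' 0 (proj y) - D (proj y))}
  have hTclosed : IsClosed T := isClosed_eq (D' 0).continuous (by fun_prop)
  have hTimage : IsClosed (h '' T) := h.isClosedMap T hTclosed
  have hsub : Set.range (fun t : ℝ => proj (dispLift D y + t • S.vu)) ⊆ h '' T := by
    rintro _ ⟨t, rfl⟩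
    obtain ⟨z, hz⟩ := hsurj (dispLift D y + t • S.vu)
    refine ⟨proj z, ?_, by rw [← proj_dispLift hD, hz]⟩
    have h1 := hleaf t z hz
    simp only [dispLift] at h1
    change D' 0 (proj z) = D (proj z) + (D' 0 (proj y) - D (proj y))
    have h2 : D' 0 (proj z) - D' 0 (proj y) = D (proj z) - D (proj y) := by
      rw [add_sub_add_comm, add_sub_add_comm] at h1
      exact add_left_cancel h1
    rw [sub_eq_iff_eq_add] at h2
    rw [h2]
    abel
  have huniv : h '' T = Set.univ := by
    have h1 := (S.denseRange_leaf (dispLift D y)).closure_range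
    exact Set.eq_univ_of_univ_subset (h1 ▸ hTimage.closure_subset_iff.2 hsub)
  obtain ⟨x', hx', hxx⟩ : h x ∈ h '' T := huniv ▸ Set.mem_univ _
  rw [← h.injective hxx]
  exact hx'

/-- Conjugacies to a hyperbolic automorphism that are homotopic to the identity are unique up to
translations. -/
theorem exists_eq_add_const_of_conj {A : GL (Fin 2) ℤ} (S : HyperbolicSplitting (planeMap A.val))
    {f : Torus → Torus} {φ ψ : Plane → Plane} (hφ : Continuous φ)
    (hl : ∀ v, proj (φ v) = f (proj v)) (hφψ : Function.LeftInverse φ ψ) {h h' : Torus → Torus}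
    {D D' : C(Torus, Plane)} (hD : ∀ x, h x = x + proj (D x)) (hD' : ∀ x, h' x = x + proj (D' x))
    (hc : ∀ x, h (f x) = toralMap A.val (h x)) (hc' : ∀ x, h' (f x) = toralMap A.val (h' x)) :
    ∃ a, ∀ x, h' x = h x + a := by
  -- The discrepancy `q` is bounded and is carried by `φ` through the linear map, so it has a
  -- bounded orbit in both time directions and hyperbolicity forces it to vanish.
  let q : Plane → Plane → Plane := fun v w =>
    (dispLift D' v - dispLift D' w) - (dispLift D v - dispLift D w)
  have hq : ∀ v w, q v w = (D' (proj v) - D' (proj w)) - (D (proj v) - D (proj w)) := by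
    intro v w
    simp only [q, dispLift]
    abel
  have hbound : ∀ v w, ‖q v w‖ ≤ (‖D'‖ + ‖D'‖) + (‖D‖ + ‖D‖) := by
    intro v w
    rw [hq]
    refine (norm_sub_le _ _).trans (add_le_add ((norm_sub_le _ _).trans ?_)
      ((norm_sub_le _ _).trans ?_)) <;>
    exact add_le_add (ContinuousMap.norm_coe_le_norm _ _) (ContinuousMap.norm_coe_le_norm _ _)
  have hqn : ∀ n v w, q (φ^[n] v) (φ^[n] w) = (planeMap A.val ^ n) (q v w) := by
    intro n v w
    have h1 := dispLift_sub_iterate (D := fun _ => D) (h := fun _ => h) (fun _ => hD) hφ hl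
      (fun _ => hc) n 0 v w
    have h2 := dispLift_sub_iterate (D := fun _ => D') (h := fun _ => h') (fun _ => hD') hφ hl
      (fun _ => hc') n 0 v w
    simp only [q]
    rw [h1, h2, ← map_sub]
  have hzero : ∀ v w, q v w = 0 := by
    intro v w
    have hu : S.ℓu (q v w) = 0 :=
      S.ℓu_eq_zero_of_bounded fun n => by rw [← hqn]; exact hbound _ _
    have hs : S.ℓs (q v w) = 0 := S.ℓs_eq_zero_of_bounded fun n =>
      ⟨q (ψ^[n] v) (ψ^[n] w), by
        rw [← hqn, hφψ.iterate n v, hφψ.iterate n w], hbound _ _⟩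
    rw [S.decomp (q v w), hu, hs, zero_smul, zero_smul, add_zero]
  refine ⟨proj (D' 0 - D 0), fun x => ?_⟩
  obtain ⟨v, rfl⟩ := proj_surjective x
  have h1 := hzero v 0
  rw [hq, proj_zero, sub_sub_sub_comm, sub_eq_zero] at h1
  rw [hD, hD', ← h1, proj_sub]
  abel

/-! ### Stable leaves -/

theorem toralMap_sub (A : Matrix (Fin 2) (Fin 2) ℤ) (x y : Torus) :
    toralMap A (x - y) = toralMap A x - toralMap A y := by
  funext i
  simp only [toralMap, ContinuousMap.coe_mk, Fin.sum_univ_two, Pi.sub_apply, smul_sub]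
  abel

theorem intVec_eq_zero_of_norm_lt_one {k : Fin 2 → ℤ} (hk : ‖intVec k‖ < 1) : intVec k = 0 := by
  ext i
  have h1 : |(k i : ℝ)| < 1 := (PiLp.norm_apply_le (intVec k) i).trans_lt hk
  have h2 : k i = 0 := Int.abs_lt_one_iff.1 (by exact_mod_cast h1)
  simp [h2]

/-- The points of the torus attracted to `0` by a toral automorphism are the projections of the
stable vectors. -/
theorem tendsto_toralMap_pow_iff (A : GL (Fin 2) ℤ) (p : Torus) :
    Tendsto (fun n : ℕ => toralMap (A.val ^ n) p) atTop (𝓝 0) ↔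
      ∃ v ∈ stableSpace A, p = proj v := by
  constructor
  · intro hp
    -- For large `n`, the small lifts satisfy `A (w n) = w (n + 1)`, since the difference is a
    -- lattice vector of norm below `1`. From then on they form a linear orbit, which is pulled back
    -- to time `0`.
    choose w hw hwn using fun n : ℕ => exists_small_lift (toralMap (A.val ^ n) p)
    have hw0 : Tendsto w atTop (𝓝 0) := by
      refine squeeze_zero_norm hwn ?_
      have := hp.norm.const_mul 2
      rwa [norm_zero, mul_zero] at this
    have hd : Tendsto (fun n => planeMap A.val (w n) - w (n + 1)) atTop (𝓝 0) := by
      have h1 := ((planeMap A.val).continuous.tendsto 0).comp hw0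
      rw [map_zero] at h1
      have := h1.sub (hw0.comp (tendsto_add_atTop_nat 1))
      rwa [sub_zero] at this
    have hd1 := hd.norm.eventually (gt_mem_nhds (by rw [norm_zero]; exact one_pos))
    obtain ⟨N, hN⟩ := eventually_atTop.1 hd1
    have hstep : ∀ n, N ≤ n → planeMap A.val (w n) = w (n + 1) := by
      intro n hn
      have h1 : proj (planeMap A.val (w n) - w (n + 1)) = 0 := by
        rw [proj_sub, proj_planeMap, hw, hw, toralMap_mul, ← pow_succ', sub_self]
      obtain ⟨k, hk⟩ := proj_eq_zero_iff.1 h1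
      have h2 := hN n hn
      rw [hk] at h2
      rw [intVec_eq_zero_of_norm_lt_one h2] at hk
      exact sub_eq_zero.1 hk
    have hiter : ∀ n, (planeMap A.val ^ n) (w N) = w (N + n) := by
      intro n
      induction n with
      | zero => simp
      | succ n ih => rw [pow_succ', mul_apply_eq_comp, ih, hstep _ (Nat.le_add_right _ _)]; rfl
    let v := planeMap ((A⁻¹) ^ N).val (w N)
    have hv : (planeMap A.val ^ N) v = w N := by
      rw [← planeMap_pow, ← Units.val_pow_eq_pow_val]
      have := planeMap_apply_inv (A ^ N) (w N)
      rwa [← inv_pow] at this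
    refine ⟨v, ?_, ?_⟩
    · change Tendsto (fun n : ℕ => (planeMap A.val ^ n) v) atTop (𝓝 0)
      refine (tendsto_add_atTop_iff_nat N).1 ?_
      have h1 : (fun n => (planeMap A.val ^ (n + N)) v) = fun n => w (n + N) := by
        funext n
        rw [pow_add, mul_apply_eq_comp, hv, hiter, add_comm]
      rw [h1]
      exact hw0.comp (tendsto_add_atTop_nat N)
    · rw [proj_planeMap, hw, toralMap_mul, ← Units.val_pow_eq_pow_val, ← Units.val_mul, inv_pow,
        inv_mul_cancel, Units.val_one, toralMap_one]
  · rintro ⟨v, hv, rfl⟩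
    have h1 : (fun n : ℕ => toralMap (A.val ^ n) (proj v))
        = fun n => proj ((planeMap A.val ^ n) v) := by
      funext n
      rw [← planeMap_pow, proj_planeMap]
    rw [h1, ← proj_zero]
    exact (continuous_proj.tendsto 0).comp hv

/-- Semiconjugacies converging in the future to a conjugacy map stable leaves to linear ones. -/
theorem image_stableLeaf_eq {A : GL (Fin 2) ℤ} {g : Diff2} {h : ℕ → Torus ≃ₜ Torus}
    (hc : ∀ n x, h (n + 1) (g x) = toralMap A.val (h n x)) (h' : Torus ≃ₜ Torus)
    (hlim : TendstoUniformly (fun n x => h n x) h' atTop) :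
    MapsLeaves (h 0) (stableLeaf g) (linStableLeaf A) := by
  have hiter : ∀ n x, h n (g^[n] x) = toralMap (A.val ^ n) (h 0 x) := by
    intro n x
    induction n with
    | zero => simp [toralMap_one]
    | succ n ih => rw [Function.iterate_succ_apply', hc, ih, toralMap_mul, ← pow_succ']
  have huc : UniformContinuous h' := CompactSpace.uniformContinuous_of_continuous h'.continuous
  have huc' : UniformContinuous h'.symm :=
    CompactSpace.uniformContinuous_of_continuous h'.symm.continuous
  -- Asymptoticity is transferred through `h'` and back by uniform continuity, then to the maps `h
  -- n` by uniform convergence, where it becomes a statement about powers of `A`.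
  have hmem : ∀ x y, y ∈ stableLeaf g x ↔ h 0 y ∈ linStableLeaf A (h 0 x) := by
    intro x y
    have e1 : y ∈ stableLeaf g x ↔
        Tendsto (fun n : ℕ => dist (h' (g^[n] x)) (h' (g^[n] y))) atTop (𝓝 0) := by
      change Tendsto (fun n : ℕ => dist (g^[n] x) (g^[n] y)) atTop (𝓝 0) ↔ _
      constructor
      · exact fun ht => tendsto_uniformity_iff_dist_tendsto_zero.1
          (Tendsto.comp huc (tendsto_uniformity_iff_dist_tendsto_zero
            (f := fun n : ℕ => (g^[n] x, g^[n] y)) |>.2 ht))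
      · intro ht
        have := tendsto_uniformity_iff_dist_tendsto_zero.1
          (Tendsto.comp huc' (tendsto_uniformity_iff_dist_tendsto_zero
            (f := fun n : ℕ => (h' (g^[n] x), h' (g^[n] y))) |>.2 ht))
        simpa [Function.comp_def] using this
    have hsup : ∀ z : ℕ → Torus, Tendsto (fun n => dist (h n (z n)) (h' (z n))) atTop (𝓝 0) := by
      intro z
      rw [Metric.tendsto_atTop]
      intro ε hε
      obtain ⟨N, hN⟩ := eventually_atTop.1 (Metric.tendstoUniformly_iff.1 hlim ε hε)
      refine ⟨N, fun n hn => ?_⟩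
      rw [Real.dist_0_eq_abs, abs_of_nonneg dist_nonneg, dist_comm]
      exact hN n hn _
    have hx := hsup fun n => g^[n] x
    have hy := hsup fun n => g^[n] y
    have hsum := hx.add hy
    rw [add_zero] at hsum
    have e2 : Tendsto (fun n : ℕ => dist (h' (g^[n] x)) (h' (g^[n] y))) atTop (𝓝 0) ↔
        Tendsto (fun n : ℕ => dist (h n (g^[n] x)) (h n (g^[n] y))) atTop (𝓝 0) := by
      constructor
      · intro ht
        have h1 := ht.add hsum
        rw [add_zero] at h1
        refine squeeze_zero (fun _ => dist_nonneg) (fun n => ?_) h1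
        have h2 := dist_triangle4 (h n (g^[n] x)) (h' (g^[n] x)) (h' (g^[n] y)) (h n (g^[n] y))
        rw [dist_comm (h' (g^[n] y)) (h n (g^[n] y))] at h2
        linarith
      · intro ht
        have h1 := ht.add hsum
        rw [add_zero] at h1
        refine squeeze_zero (fun _ => dist_nonneg) (fun n => ?_) h1
        have h2 := dist_triangle4 (h' (g^[n] x)) (h n (g^[n] x)) (h n (g^[n] y)) (h' (g^[n] y))
        rw [dist_comm (h' (g^[n] x)) (h n (g^[n] x))] at h2
        linarith
    have e3 : (fun n : ℕ => dist (h n (g^[n] x)) (h n (g^[n] y)))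
        = fun n => ‖toralMap (A.val ^ n) (h 0 y - h 0 x)‖ := by
      funext n
      rw [hiter, hiter, toralMap_sub, dist_comm, dist_eq_norm]
    rw [e1, e2, e3, ← tendsto_zero_iff_norm_tendsto_zero, tendsto_toralMap_pow_iff]
    simp only [linStableLeaf, Set.mem_ofPred_eq, sub_eq_iff_eq_add']
  intro x
  ext z
  constructor
  · rintro ⟨y, hy, rfl⟩
    exact (hmem x y).1 hy
  · intro hz
    obtain ⟨y, rfl⟩ := (h 0).surjective z
    exact ⟨y, (hmem x y).2 hz, rfl⟩

theorem MapsLeaves.add_const {A : GL (Fin 2) ℤ} {F : Torus → Set Torus} {h h' : Torus ≃ₜ Torus}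
    {a : Torus} (hL : MapsLeaves h F (linStableLeaf A)) (ha : ∀ x, h' x = h x + a) :
    MapsLeaves h' F (linStableLeaf A) := by
  intro x
  ext z
  have key : z ∈ linStableLeaf A (h' x) ↔ z - a ∈ linStableLeaf A (h x) := by
    simp only [linStableLeaf, Set.mem_ofPred_eq, ha, sub_eq_iff_eq_add, add_right_comm]
  rw [key, ← hL x]
  simp only [Set.mem_image, ha, eq_sub_iff_add_eq]

/-! ### Invertible lifts -/

/-- The composition of the chosen lifts of `f` and its inverse is translation by a lattice vector
`m`, so subtracting `m` gives a left inverse. In the other order the error is also constant, and it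
vanishes at `f.lift 0`. -/
theorem Diff2.exists_inverse_lift (f : Diff2) : ∃ ψ : Plane → Plane, ContDiff ℝ 1 ψ ∧
    (∀ v, proj (ψ v) = f.symm (proj v)) ∧ Function.LeftInverse ψ f.lift ∧
    Function.LeftInverse f.lift ψ := by
  let m := f.symm.lift (f.lift 0) - 0
  have hm : ∀ v, f.symm.lift (f.lift v) - v = m := fun v =>
    eq_of_forall_proj_eq_zero (δ := fun v => f.symm.lift (f.lift v) - v)
      ((f.symm.contDiff_lift.continuous.comp f.contDiff_lift.continuous).sub continuous_id)
      (fun x => by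
        rw [proj_sub, f.symm.proj_lift, f.proj_lift, sub_eq_zero]
        exact f.toHomeo.symm_apply_apply _) v 0
  have hpm : proj m = 0 := by
    simp only [m]
    rw [proj_sub, f.symm.proj_lift, f.proj_lift, sub_eq_zero]
    exact f.toHomeo.symm_apply_apply _
  have hl : ∀ v, proj (f.symm.lift v - m) = f.symm (proj v) := fun v => by
    rw [proj_sub, hpm, sub_zero, f.symm.proj_lift]
  have hleft : ∀ v, f.symm.lift (f.lift v) - m = v := fun v => by
    rw [← hm v, sub_sub_cancel]
  refine ⟨fun v => f.symm.lift v - m,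
    (f.symm.contDiff_lift.of_le one_le_two).sub contDiff_const, hl, hleft, fun v => ?_⟩
  have h2 := eq_of_forall_proj_eq_zero (δ := fun v => f.lift (f.symm.lift v - m) - v)
    ((f.contDiff_lift.continuous.comp
      (f.symm.contDiff_lift.continuous.sub continuous_const)).sub continuous_id)
    (fun x => by
      rw [proj_sub, f.proj_lift, hl, sub_eq_zero]
      exact f.toHomeo.apply_symm_apply _) v (f.lift 0)
  simp only [hleft, sub_self] at h2
  exact sub_eq_zero.1 h2

/-! ### Words and fiberwise conjugacies -/

section Words

variable {𝒦 : Set Diff2}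

/-- The word with letters `a` before position `j`, and `b` from there on. -/
def switchWord (a b : 𝒦) (j : ℤ) : Words 𝒦 := fun m => if m < j then a else b

theorem shift_switchWord (a b : 𝒦) (j : ℤ) :
    shift (switchWord a b (j + 1)) = switchWord a b j := by
  funext m
  simp [shift, switchWord]

theorem tendsto_switchWord (a b : 𝒦) :
    Tendsto (fun n : ℕ => switchWord a b n) atTop (𝓝 fun _ => a) := by
  refine tendsto_pi_nhds.2 fun m => tendsto_const_nhds.congr' ?_
  filter_upwards [eventually_gt_atTop m.toNat] with n hn
  have : m < n := by omega
  simp [switchWord, this]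

theorem tendsto_switchWord_neg (a b : 𝒦) :
    Tendsto (fun n : ℕ => switchWord a b (-n)) atTop (𝓝 fun _ => b) := by
  refine tendsto_pi_nhds.2 fun m => tendsto_const_nhds.congr' ?_
  filter_upwards [eventually_gt_atTop (-m).toNat] with n hn
  have : ¬ m < -(n : ℤ) := by omega
  simp [switchWord, this]

theorem backIter_eq {a : 𝒦} {ω : Words 𝒦} (hω : ∀ m < 0, ω m = a) (n : ℕ) (x : Torus) :
    backIter ω n x = (a.1.symm)^[n] x := by
  induction n with
  | zero => rfl
  | succ n ih =>
    rw [Function.iterate_succ_apply', ← ih]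
    simp only [backIter]
    rw [hω _ (by omega)]

/-- Backward iterates shrink the curve at rate `r ^ n`. They involve only the negative letters, so
the same curves serve every word with past `a`. -/
theorem isUnstableParam_of_integral_curve {a : 𝒦} {ω : Words 𝒦} (hω : ∀ m < 0, ω m = a)
    {ψ e : Plane → Plane} (hψ : ContDiff ℝ 1 ψ) (hl : ∀ v, proj (ψ v) = a.1.symm (proj v))
    (he : Continuous e) (he1 : ∀ v, ‖e v‖ = 1) {K r : ℝ} (hr0 : 0 ≤ r) (hr : r < 1)
    (hcontr : ∀ v (n : ℕ), ‖fderiv ℝ ψ^[n] v (e v)‖ ≤ K * r ^ n) {c : ℝ → Plane}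
    (hc : ∀ t, HasDerivAt c (e (c t)) t) : IsUnstableParam ω c where
  contDiff := by
    have hd : Differentiable ℝ c := fun t => (hc t).differentiableAt
    refine contDiff_one_iff_deriv.2 ⟨hd, ?_⟩
    have : deriv c = fun t => e (c t) := funext fun t => (hc t).deriv
    rw [this]
    exact he.comp hd.continuous
  unit_speed t := by rw [(hc t).deriv, he1]
  mem_leaf t := by
    have hiter : ∀ n v, backIter ω n (proj v) = proj (ψ^[n] v) := by
      intro n v
      rw [backIter_eq hω]
      induction n with
      | zero => rfl
      | succ n ih => rw [Function.iterate_succ_apply', Function.iterate_succ_apply', hl, ih]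
    have hlim : Tendsto (fun n : ℕ => K * r ^ n * |0 - t|) atTop (𝓝 0) := by
      have := ((tendsto_pow_atTop_nhds_zero_of_lt_one hr0 hr).const_mul K).mul_const |0 - t|
      rwa [mul_zero, zero_mul] at this
    refine squeeze_zero (fun _ => dist_nonneg) (fun n => ?_) hlim
    rw [hiter, hiter]
    exact (dist_proj_le _ _).trans (norm_iterate_sub_le_of_integral_curve hψ hcontr hc n 0 t)

variable {H : (Words 𝒦 × Torus) ≃ₜ (Words 𝒦 × Torus)}

theorem IsFiberConj.conj_snd (hH : IsFiberConj H) (ω : Words 𝒦) (x : Torus) :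
    (H (shift ω, (ω 0).1 x)).2 = toralMap (linPart (ω 0).1).val (H (ω, x)).2 := by
  have h1 := congrArg Prod.snd (hH.conj (ω, x))
  have h2 := hH.fst_eq (ω, x)
  simp only [linSkew, skew, h2] at h1
  exact h1

theorem IsFiberConj.exists_fiber_homeomorph (hH : IsFiberConj H) (ω : Words 𝒦) :
    ∃ h : Torus ≃ₜ Torus, ∀ x, h x = (H (ω, x)).2 := by
  have hpair : ∀ x, H (ω, x) = (ω, (H (ω, x)).2) := fun x => Prod.ext (hH.fst_eq _) rfl
  have hb : Function.Bijective fun x => (H (ω, x)).2 := by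
    constructor
    · intro x y hxy
      have : H (ω, x) = H (ω, y) := by rw [hpair x, hpair y]; exact Prod.ext rfl hxy
      exact congrArg Prod.snd (H.injective this)
    · intro y
      obtain ⟨⟨ω', x⟩, hx⟩ := H.surjective (ω, y)
      have h1 := hH.fst_eq (ω', x)
      rw [hx] at h1
      simp only at h1
      subst h1
      exact ⟨x, congrArg Prod.snd hx⟩
  exact ⟨Continuous.homeoOfEquivCompactToT2 (f := Equiv.ofBijective _ hb)
    (by change Continuous fun x => (H (ω, x)).2; fun_prop), fun x => rfl⟩

/-- Currying a jointly continuous map gives a continuous map into the compact-open topology, which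
is uniform convergence on the compact torus. -/
theorem tendstoUniformly_fiber {ω : ℕ → Words 𝒦} {ω' : Words 𝒦}
    (hω : Tendsto ω atTop (𝓝 ω')) :
    TendstoUniformly (fun n x => (H (ω n, x)).2) (fun x => (H (ω', x)).2) atTop := by
  let G : C(Words 𝒦 × Torus, Torus) := ⟨fun p => (H p).2, by fun_prop⟩
  have h1 : Tendsto (fun n => G.curry (ω n)) atTop (𝓝 (G.curry ω')) :=
    (G.curry.continuous.tendsto ω').comp hω
  exact ContinuousMap.tendsto_iff_tendstoUniformly.1 h1

end Words

/-! ### Comparison of fiber maps, and images of stable leaves. -/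

section Words

variable {𝒦 : Set Diff2} {H : (Words 𝒦 × Torus) ≃ₜ (Words 𝒦 × Torus)}

/-- The fiber map over a word with past `f` is the composition of the fiber map over the constant
word `f` with a translation. -/
theorem IsFiberConj.exists_switchWord_eq_add (hH : IsFiberConj H)
    (hsmooth : IsC1PlusAlongUnstable H) (h𝒦 : ConeHyperbolic 𝒦) (f g : 𝒦)
    (S : HyperbolicSplitting (planeMap (linPart f.1).val)) :
    ∃ a, ∀ x, (H (switchWord f g 0, x)).2 = (H (fun _ => f, x)).2 + a := by
  obtain ⟨M, Cs, Cu, γ, hγ, hexp⟩ := h𝒦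
  obtain ⟨hs, hu⟩ := hexp f.1 f.2
  obtain ⟨ψ, hψ, hψl, hψφ, hφψ⟩ := f.1.exists_inverse_lift
  have hφ : ContDiff ℝ 1 f.1.lift := f.1.contDiff_lift.of_le one_le_two
  have hr0 : 0 ≤ Real.exp (-γ) := (Real.exp_pos _).le
  have hr : Real.exp (-γ) < 1 := by simpa using hγ
  obtain ⟨K, hK, hgr⟩ := hu.exists_hasGrowth hφ f.1.proj_lift
  obtain ⟨K', hK', hgr'⟩ := hs.exists_hasGrowth hψ hψl
  obtain ⟨e, he, he1, hcontr⟩ :=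
    exists_unit_field hφ hψ hψφ hφψ hr0 hr hgr hK'.le hgr'
  choose D hD using fun ω : Words 𝒦 => exists_displacement (hH.homotopic ω)
  simp only [ContinuousMap.coe_mk] at hD
  obtain ⟨DH, _, _, -, hDH, -, hder⟩ := hsmooth
  let DHc : C(Words 𝒦 × Torus, Plane →L[ℝ] Plane) := ⟨DH, hDH⟩
  obtain ⟨h, hh⟩ := hH.exists_fiber_homeomorph fun _ => f
  have hconst : ∀ ω : Words 𝒦, (∀ m < 0, ω m = f) → ∀ c : ℝ → Plane,
      (∀ t, HasDerivAt c (e (c t)) t) → ∀ t,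
        HasDerivAt (fun t => dispLift (D ω) (c t)) (DH (ω, proj (c t)) (e (c t))) t := by
    intro ω hω c hc t
    have hcont : Continuous c := continuous_iff_continuousAt.2 fun t => (hc t).continuousAt
    have h1 := (hder ω c (fun t => dispLift (D ω) (c t))
      (isUnstableParam_of_integral_curve hω hψ hψl he he1 hr0 hr hcontr hc)
      ((continuous_dispLift _).comp hcont) (fun t => proj_dispLift (hD ω) _)).1 t
    rwa [(hc t).deriv] at h1
  obtain ⟨a, ha⟩ := exists_displacement_eq_add_const S hφ.continuous hψ f.1.proj_lift hφψ he he1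
    hK.le hr0 hr hcontr h (D := D fun _ => f) (fun x => by rw [hh, hD])
    (fun x => by
      rw [hh, hh]
      exact hH.conj_snd (fun _ => f) x)
    (h' := fun n x => (H (switchWord f g n, x)).2) (D' := fun n => D (switchWord f g n))
    (fun n x => hD _ x)
    -- The word switching at `n + 1` has letter `f` at `0` and shifts to the one switching at `n`,
    -- so the relation runs from index `n` to `n + 1`.
    (fun n x => by
      have h1 := hH.conj_snd (switchWord f g (n + 1)) x
      have h2 : switchWord f g (n + 1) 0 = f := if_pos (by positivity)
      rw [shift_switchWord, h2] at h1
      simpa using h1)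
    (G := DHc.curry fun _ => f) (G' := fun n => DHc.curry (switchWord f g n))
    ((DHc.curry.continuous.tendsto _).comp (tendsto_switchWord f g))
    (fun c hc => ⟨hconst _ (fun _ _ => rfl) c hc, fun n =>
      hconst _ (fun m hm => if_pos (by omega)) c hc⟩)
  refine ⟨proj a, fun x => ?_⟩
  have h1 := ha x
  simp only [Nat.cast_zero] at h1
  rw [hD, hD, h1, proj_add, add_assoc]

/-- The fiber map over the word with past `f` and future `g` straightens the stable leaves of `g`
because of its future, and is a translate of `Hf` because of its past. -/
theorem mapsLeaves_of_fiberConj (hH : IsFiberConj H) (hsmooth : IsC1PlusAlongUnstable H)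
    (h𝒦 : ConeHyperbolic 𝒦) (f g : 𝒦) (S : HyperbolicSplitting (planeMap (linPart f.1).val))
    {Hf : Torus ≃ₜ Torus} (hHf : IsLinConj f.1 Hf) :
    MapsLeaves Hf (stableLeaf g.1) (linStableLeaf (linPart g.1)) := by
  obtain ⟨a, ha⟩ := hH.exists_switchWord_eq_add hsmooth h𝒦 f g S
  obtain ⟨D, hD⟩ := exists_displacement hHf.2
  obtain ⟨D', hD'⟩ := exists_displacement (hH.homotopic fun _ => f)
  obtain ⟨ψ, -, -, -, hφψ⟩ := f.1.exists_inverse_lift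
  obtain ⟨a', ha'⟩ := exists_eq_add_const_of_conj S f.1.contDiff_lift.continuous f.1.proj_lift
    hφψ hD' hD (hH.conj_snd fun _ => f) hHf.1
  choose h hh using fun n : ℕ => hH.exists_fiber_homeomorph (switchWord f g (-n))
  obtain ⟨h', hh'⟩ := hH.exists_fiber_homeomorph fun _ => g
  have hmaps := image_stableLeaf_eq (A := linPart g.1) (g := g.1) (h := h) (fun n x => by
      have h1 := hH.conj_snd (switchWord f g (-n)) x
      have h2 : switchWord f g (-n) 0 = g := if_neg (by omega)
      have h3 := shift_switchWord f g (-n - 1)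
      rw [sub_add_cancel] at h3
      rw [h2, h3] at h1
      rw [hh, hh, ← h1]
      congr 4
      push_cast
      ring) h' (by
      have := tendstoUniformly_fiber (H := H) (tendsto_switchWord_neg f g)
      simpa only [← hh, ← hh'] using this)
  refine hmaps.add_const (a := -a + a') fun x => ?_
  have h0 : h 0 x = (H (switchWord f g 0, x)).2 := by rw [hh]; rfl
  have h1 := ha' x
  simp only [ContinuousMap.coe_mk] at h1
  rw [h0, ha, h1]
  abel

end Words

end

theorem proposition7p2
    (𝒜 : Finset (GL (Fin 2) ℤ)) (h𝒜 : ConeHyperbolic (toralAut '' (𝒜 : Set (GL (Fin 2) ℤ))))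
    (𝒦 : Set Diff2) (h𝒦 : ConeHyperbolic 𝒦) (hlin : ∀ f ∈ 𝒦, linPart f ∈ 𝒜)
    (H : (Words 𝒦 × Torus) ≃ₜ (Words 𝒦 × Torus)) (hH : IsFiberConj H)
    (hsmooth : IsC1PlusAlongUnstable H)
    (f : Diff2) (hf : f ∈ 𝒦) (g : Diff2) (hg : g ∈ 𝒦)
    (Hf : Torus ≃ₜ Torus) (hHf : IsLinConj f Hf) (Hg : Torus ≃ₜ Torus) (hHg : IsLinConj g Hg) :
    MapsLeaves Hf (stableLeaf g) (linStableLeaf (linPart g)) ∧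
      MapsLeaves Hg (stableLeaf f) (linStableLeaf (linPart f)) := by
  obtain ⟨Sf⟩ := nonempty_hyperbolicSplitting h𝒜 (hlin f hf)
  obtain ⟨Sg⟩ := nonempty_hyperbolicSplitting h𝒜 (hlin g hg)
  exact ⟨mapsLeaves_of_fiberConj hH hsmooth h𝒦 ⟨f, hf⟩ ⟨g, hg⟩ Sf hHf,
    mapsLeaves_of_fiberConj hH hsmooth h𝒦 ⟨g, hg⟩ ⟨f, hf⟩ Sg hHg⟩
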